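/- Let $d\ge 1$ and let $\Omega\subset\mathbb{R}^d$ be a bounded open set with piecewise smooth boundary, in the following sense: $\mathcal H^{d-1}(\partial\Omega)<\infty$, and for $\mathcal H^{d-1}$-almost every $\boldsymbol x\in\partial\Omega$ there is a function $\rho$, $C^1$ near $\boldsymbol x$ with $\nabla\rho(\boldsymbol x)\neq 0$, such that $\Omega$ coincides with $\{\rho<0\}$ near $\boldsymbol x$; at such points $\boldsymbol n=\nabla\rho/\|\nabla\rho\|$ is the outward pointing unit normal. Here $\mathcal H^{d-1}$ is the $(d-1)$-dimensional Hausdorff (surface) measure, and $\oint_{\partial\Omega}\cdots\,\mathrm ds$ is integration with respect to it. Let $\boldsymbol\xi\in\mathbb{R}^d$ with $\|\boldsymbol\xi\|=1$ and $\partial_{\boldsymbol\xi}f=\nabla f\cdot\boldsymbol\xi$. Let $C^1(\overline\Omega)$ be the space of functions that are continuous on $\overline\Omega$ and $C^1$ in $\Omega$ and whose gradient extends continuously to $\overline\Omega$ (at boundary points, $\partial_{\boldsymbol\xi}f$ denotes this extension). Let $S=\{\boldsymbol x_1,\dots,\boldsymbol x_N\}\subset\overline\Omega$ be a set of $N$ nodes,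 and for a function $f$ write $\mathbf f=[f(\boldsymbol x_1),\dots,f(\boldsymbol x_N)]^T$ and $\mathbf f_{\boldsymbol\xi}=[(\partial_{\boldsymbol\xi}f)(\boldsymbol x_1),\dots,(\partial_{\boldsymbol\xi}f)(\boldsymbol x_N)]^T$. Let $\mathcal F\subset C^1(\overline\Omega)$ be a linear subspace with a finite basis $f_1,\dots,f_K$, and assume that the Vandermonde matrix $V=[\mathbf f_1,\dots,\mathbf f_K]\in\mathbb{R}^{N\times K}$ has linearly independent columns. Let $B\in\mathbb{R}^{N\times N}$ be a symmetric matrix satisfying the boundary exactness condition $$\mathbf f^T B\,\mathbf g=\oint_{\partial\Omega} f g\,(\boldsymbol\xi\cdot\boldsymbol n)\,\mathrm ds\qquad\text{for all } f,g\in\mathcal F .\tag{iv}$$ Then the following are equivalent. 1. There is a diagonal-norm $\mathcal F$-based multi-dimensional function-space summation-by-parts (MFSBP) operator on $S$ with boundary matrix $B$, that is, there are $D,P,Q\in\mathbb{R}^{N\times N}$ such that $P$ is diagonal and symmetric positive definite, $D=P^{-1}Q$, $Q+Q^T=B$, $D\mathbf f=\mathbf f_{\boldsymbol\xi}$ for all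 $f\in\mathcal F$, and (iv) holds. 2. There is a positive and $\partial_{\boldsymbol\xi}(\mathcal F^2)$-exact quadrature on $\Omega$ with nodes $S$, that is, there are weights $w_1,\dots,w_N>0$ such that $\sum_{n=1}^N w_n h(\boldsymbol x_n)=\int_\Omega h\,\mathrm d\boldsymbol x$ for every $h\in\partial_{\boldsymbol\xi}(\mathcal F^2)=\{\partial_{\boldsymbol\xi}(fg)\mid f,g\in\mathcal F\}$. -/

import Mathlib

open MeasureTheory Topology
open scoped Matrix

noncomputable section

namespace MFSBP

variable {d N : ℕ}

/-! ### Domains with piecewise smooth boundary -/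

/-- `ρ` is a `C¹` defining function of `Ω` near the point `x`:
near `x` the set `Ω` is `{ρ < 0}`, and the gradient of `ρ` at `x` is nonzero. -/
structure IsDefiningFunctionAt (Ω : Set (EuclideanSpace ℝ (Fin d)))
    (ρ : EuclideanSpace ℝ (Fin d) → ℝ) (x : EuclideanSpace ℝ (Fin d)) : Prop where
  contDiffAt : ContDiffAt ℝ 1 ρ x
  gradient_ne_zero : gradient ρ x ≠ 0
  eventually_mem_iff : ∀ᶠ y in 𝓝 x, (y ∈ Ω ↔ ρ y < 0)

/-- The smooth part of the boundary: the boundary points at which a `C¹` defining function exists. -/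
def smoothBoundary (Ω : Set (EuclideanSpace ℝ (Fin d))) : Set (EuclideanSpace ℝ (Fin d)) :=
  {x ∈ frontier Ω | ∃ ρ, IsDefiningFunctionAt Ω ρ x}

/-- The boundary has finite surface measure and is smooth outside a set (corners, edges, ...) of
surface measure zero. The surface measure is the `(d-1)`-dimensional Hausdorff measure, normalised
to agree with the Lebesgue measure on `ℝ^(d-1)`. -/
structure HasPiecewiseSmoothBoundary (Ω : Set (EuclideanSpace ℝ (Fin d))) : Prop where
  measure_ne_top : μHE[d - 1] (frontier Ω) ≠ ⊤
  measure_singular : μHE[d - 1] (frontier Ω \ smoothBoundary Ω) = 0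

open Classical in
/-- The outward pointing unit normal `n = ∇ρ / ‖∇ρ‖`, where `ρ` is a local defining function of `Ω`
(the choice of `ρ` is irrelevant, see `outwardNormal_eq`); the value is `0` where there is none. -/
def outwardNormal (Ω : Set (EuclideanSpace ℝ (Fin d))) (x : EuclideanSpace ℝ (Fin d)) :
    EuclideanSpace ℝ (Fin d) :=
  if h : ∃ ρ, IsDefiningFunctionAt Ω ρ x then ‖gradient h.choose x‖⁻¹ • gradient h.choose x else 0

/-- Surface integral over the boundary of `Ω`. -/
def surfaceIntegral (Ω : Set (EuclideanSpace ℝ (Fin d))) (h : EuclideanSpace ℝ (Fin d) → ℝ) : ℝ :=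
  ∫ y in frontier Ω, h y ∂μHE[d - 1]

/-! ### Functions that are continuously differentiable up to the boundary -/

/-- Functions that are `C¹` in the open set `Ω` and that have, together with their derivative, a
continuous extension to the closure of `Ω`. Only the values on the closure of `Ω` matter. -/
def C1Closure (Ω : Set (EuclideanSpace ℝ (Fin d))) : Set (EuclideanSpace ℝ (Fin d) → ℝ) :=
  {f | ContDiffOn ℝ 1 f Ω ∧ ContinuousOn f (closure Ω) ∧
    ∃ g : EuclideanSpace ℝ (Fin d) → EuclideanSpace ℝ (Fin d),
      ContinuousOn g (closure Ω) ∧ Set.EqOn g (gradient f) Ω}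

/-- The directional derivative `∂_ξ f = ∇f · ξ` in `Ω`, extended continuously to the closure. -/
def dirDeriv (Ω : Set (EuclideanSpace ℝ (Fin d))) (ξ : EuclideanSpace ℝ (Fin d))
    (f : EuclideanSpace ℝ (Fin d) → ℝ) : EuclideanSpace ℝ (Fin d) → ℝ :=
  extendFrom Ω (fun y => inner ℝ (gradient f y) ξ)

/-- The set `∂_ξ(F²) = {∂_ξ(f g) | f, g ∈ F}`. -/
def dirDerivProducts (Ω : Set (EuclideanSpace ℝ (Fin d))) (ξ : EuclideanSpace ℝ (Fin d))
    (F : Set (EuclideanSpace ℝ (Fin d) → ℝ)) : Set (EuclideanSpace ℝ (Fin d) → ℝ) :=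
  {h | ∃ f ∈ F, ∃ g ∈ F, h = dirDeriv Ω ξ (fun y => f y * g y)}

/-! ### Nodal values, Vandermonde matrix, quadratures -/

/-- The vector of nodal values of `f`. -/
def nodal (x : Fin N → EuclideanSpace ℝ (Fin d)) (f : EuclideanSpace ℝ (Fin d) → ℝ) : Fin N → ℝ :=
  fun n => f (x n)

/-- The Vandermonde matrix, with the nodal values of the functions `f k` as columns. -/
def vandermonde {K : ℕ} (x : Fin N → EuclideanSpace ℝ (Fin d))
    (f : Fin K → EuclideanSpace ℝ (Fin d) → ℝ) : Matrix (Fin N) (Fin K) ℝ :=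
  Matrix.of fun n k => f k (x n)

/-- The quadrature with nodes `x` and weights `w`. -/
def quadrature (x : Fin N → EuclideanSpace ℝ (Fin d)) (w : Fin N → ℝ)
    (g : EuclideanSpace ℝ (Fin d) → ℝ) : ℝ :=
  ∑ n, w n * g (x n)

/-- The quadrature with nodes `x` and weights `w` integrates every `g ∈ G` exactly over `Ω`. -/
def IsExactQuadrature (Ω : Set (EuclideanSpace ℝ (Fin d))) (x : Fin N → EuclideanSpace ℝ (Fin d))
    (w : Fin N → ℝ) (G : Set (EuclideanSpace ℝ (Fin d) → ℝ)) : Prop :=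
  ∀ g ∈ G, quadrature x w g = ∫ y in Ω, g y

/-! ### MFSBP operators -/

/-- The boundary exactness condition
`fᵀ B g = ∮_{∂Ω} f g (ξ · n) ds` for all `f, g ∈ F`. -/
def BoundaryExact (Ω : Set (EuclideanSpace ℝ (Fin d))) (ξ : EuclideanSpace ℝ (Fin d))
    (F : Set (EuclideanSpace ℝ (Fin d) → ℝ)) (x : Fin N → EuclideanSpace ℝ (Fin d))
    (B : Matrix (Fin N) (Fin N) ℝ) : Prop :=
  ∀ f ∈ F, ∀ g ∈ F, nodal x f ⬝ᵥ (B *ᵥ nodal x g) =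
    surfaceIntegral Ω (fun y => f y * g y * inner ℝ ξ (outwardNormal Ω y))

/-- `D = P⁻¹ Q` is an `F`-based multi-dimensional function-space summation-by-parts operator,
approximating `∂_ξ` on the nodes `x`, with boundary matrix `B`. -/
structure IsMFSBP (Ω : Set (EuclideanSpace ℝ (Fin d))) (ξ : EuclideanSpace ℝ (Fin d))
    (F : Set (EuclideanSpace ℝ (Fin d) → ℝ)) (x : Fin N → EuclideanSpace ℝ (Fin d))
    (D P Q B : Matrix (Fin N) (Fin N) ℝ) : Prop where
  eq_inv_mul : D = P⁻¹ * Q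
  exact_on : ∀ f ∈ F, D *ᵥ nodal x f = nodal x (dirDeriv Ω ξ f)
  norm_posDef : P.PosDef
  sbp : Q + Qᵀ = B
  boundary_exact : BoundaryExact Ω ξ F x B

/-! ### The outward normal does not depend on the defining function -/

section Normal

variable {Ω : Set (EuclideanSpace ℝ (Fin d))} {x : EuclideanSpace ℝ (Fin d)}
  {ρ σ : EuclideanSpace ℝ (Fin d) → ℝ}

theorem IsDefiningFunctionAt.apply_eq_zero (hx : x ∈ frontier Ω) (hΩ : IsOpen Ω)
    (h : IsDefiningFunctionAt Ω ρ x) : ρ x = 0 := by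
  have hc := h.contDiffAt.continuousAt
  rw [hΩ.frontier_eq] at hx
  refine le_antisymm ?_ ?_
  · have hf : ∃ᶠ y in 𝓝 x, y ∈ Ω := mem_closure_iff_frequently.1 hx.1
    by_contra hlt
    push Not at hlt
    have h1 : ∀ᶠ y in 𝓝 x, 0 < ρ y := hc.eventually (lt_mem_nhds hlt)
    obtain ⟨y, hy, hy1, hy2⟩ := (hf.and_eventually (h1.and h.eventually_mem_iff)).exists
    exact absurd (hy2.1 hy) (not_lt.2 hy1.le)
  · by_contra hlt
    push Not at hlt
    exact hx.2 (h.eventually_mem_iff.self_of_nhds.2 hlt)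

theorem IsDefiningFunctionAt.hasDerivAt_line (h : IsDefiningFunctionAt Ω ρ x)
    (v : EuclideanSpace ℝ (Fin d)) :
    HasDerivAt (fun t : ℝ => ρ (x + t • v)) (inner ℝ (gradient ρ x) v) 0 := by
  have h1 : HasGradientAt ρ (gradient ρ x) (x + (0 : ℝ) • v) := by
    simpa using (h.contDiffAt.differentiableAt (by norm_num)).hasGradientAt
  have h2 : HasDerivAt (fun t : ℝ => x + t • v) v 0 := by
    simpa using ((hasDerivAt_id (0 : ℝ)).smul_const v).const_add x
  simpa [Function.comp_def] using h1.hasFDerivAt.comp_hasDerivAt (0 : ℝ) h2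

theorem IsDefiningFunctionAt.inner_nonpos (hx : x ∈ frontier Ω) (hΩ : IsOpen Ω)
    (h : IsDefiningFunctionAt Ω ρ x) (k : IsDefiningFunctionAt Ω σ x)
    {v : EuclideanSpace ℝ (Fin d)} (hv : inner ℝ (gradient ρ x) v < 0) :
    inner ℝ (gradient σ x) v ≤ 0 := by
  by_contra hlt
  push Not at hlt
  have hcont : Filter.Tendsto (fun t : ℝ => x + t • v) (𝓝[>] 0) (𝓝 x) := by
    have : Continuous (fun t : ℝ => x + t • v) := by fun_prop
    have h0 := this.tendsto 0
    simp only [zero_smul, add_zero] at h0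
    exact h0.mono_left nhdsWithin_le_nhds
  have e1 : ∀ᶠ t : ℝ in 𝓝[>] 0, ρ (x + t • v) < 0 := by
    have := (h.hasDerivAt_line v).tendsto_slope_zero_right
    filter_upwards [this.eventually (gt_mem_nhds hv), self_mem_nhdsWithin] with t ht ht0
    have ht0' : (0 : ℝ) < t := ht0
    simp only [zero_add, zero_smul, add_zero, h.apply_eq_zero hx hΩ, sub_zero, smul_eq_mul] at ht
    by_contra hn
    push Not at hn
    exact absurd ht (not_lt.2 (mul_nonneg (inv_nonneg.2 ht0'.le) hn))
  have e2 : ∀ᶠ t : ℝ in 𝓝[>] 0, 0 < σ (x + t • v) := by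
    have := (k.hasDerivAt_line v).tendsto_slope_zero_right
    filter_upwards [this.eventually (lt_mem_nhds hlt), self_mem_nhdsWithin] with t ht ht0
    have ht0' : (0 : ℝ) < t := ht0
    simp only [zero_add, zero_smul, add_zero, k.apply_eq_zero hx hΩ, sub_zero, smul_eq_mul] at ht
    by_contra hn
    push Not at hn
    exact absurd ht (not_lt.2 (mul_nonpos_of_nonneg_of_nonpos (inv_nonneg.2 ht0'.le) hn))
  obtain ⟨t, h1, h2, h3, h4⟩ := (e1.and (e2.and ((hcont.eventually h.eventually_mem_iff).and
    (hcont.eventually k.eventually_mem_iff)))).exists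
  exact absurd (h4.1 (h3.2 h1)) (not_lt.2 h2.le)

theorem outwardNormal_eq (hx : x ∈ frontier Ω) (hΩ : IsOpen Ω)
    (k : IsDefiningFunctionAt Ω σ x) :
    outwardNormal Ω x = ‖gradient σ x‖⁻¹ • gradient σ x := by
  have hex : ∃ ρ, IsDefiningFunctionAt Ω ρ x := ⟨σ, k⟩
  have h := hex.choose_spec
  rw [outwardNormal, dif_pos hex]
  set a := gradient hex.choose x with ha
  set b := gradient σ x with hb
  have ha0 : 0 < ‖a‖ := norm_pos_iff.2 h.gradient_ne_zero
  have hb0 : 0 < ‖b‖ := norm_pos_iff.2 k.gradient_ne_zero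
  have na : ‖‖a‖⁻¹ • a‖ = 1 := by
    rw [norm_smul, norm_inv, norm_norm, inv_mul_cancel₀ ha0.ne']
  have nb : ‖‖b‖⁻¹ • b‖ = 1 := by
    rw [norm_smul, norm_inv, norm_norm, inv_mul_cancel₀ hb0.ne']
  by_contra hne
  have hlt : inner ℝ (‖a‖⁻¹ • a) (‖b‖⁻¹ • b) < 1 :=
    (inner_lt_one_iff_real_of_norm_eq_one na nb).2 hne
  have h1 : inner ℝ a (‖b‖⁻¹ • b - ‖a‖⁻¹ • a) < 0 := by
    have e : inner ℝ a (‖b‖⁻¹ • b - ‖a‖⁻¹ • a)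
        = ‖a‖ * (inner ℝ (‖a‖⁻¹ • a) (‖b‖⁻¹ • b) - 1) := by
      simp only [inner_sub_right, real_inner_smul_left, real_inner_smul_right,
        real_inner_self_eq_norm_sq]
      field_simp
    rw [e]
    exact mul_neg_of_pos_of_neg ha0 (by linarith)
  have h2 : 0 < inner ℝ b (‖b‖⁻¹ • b - ‖a‖⁻¹ • a) := by
    have e : inner ℝ b (‖b‖⁻¹ • b - ‖a‖⁻¹ • a)
        = ‖b‖ * (1 - inner ℝ (‖a‖⁻¹ • a) (‖b‖⁻¹ • b)) := by
      simp only [inner_sub_right, real_inner_smul_left, real_inner_smul_right,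
        real_inner_self_eq_norm_sq, real_inner_comm a b]
      field_simp
    rw [e]
    exact mul_pos hb0 (by linarith)
  exact absurd (h.inner_nonpos hx hΩ k h1) (not_le.2 h2)

end Normal

end MFSBP

end

/-! The bridge between the two statements is the divergence theorem for the field `F ξ`: applied to
`F = f g`, it and (iv) give `fᵀ B g = ∫_Ω ∂_ξ(f g)`. By the product rule, the quadrature with
weights `w` and `P = diag w` takes the value `fᵀ P g_ξ + gᵀ P f_ξ` on `∂_ξ(f g)`. If an operator is
given, `P D = Q` turns this value into `fᵀ (Q + Qᵀ) g = fᵀ B g`, so the diagonal of `P` is an exact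
positive weight vector. Conversely, given `w`, put `Q = S + B/2` with `S` skew; exactness of `D` on
the basis reads `S V = R` with `R = P V' - B V / 2`, where the columns of `V'` hold the nodal
derivatives. As `V` has independent columns, such an `S` exists once `Vᵀ R` is skew
(`exists_skew_mul_eq`), and this skewness is exactness of the quadrature on products of basis
functions.

Most of the work is the divergence theorem itself, `divergenceAlong_of_mem_C1Closure`. Near a smooth
boundary point `Ω` is a subgraph in any outward transversal direction `v`; Fubini and the
fundamental theorem of calculus on lines parallel to `v` give the flux, once the surface measure of
a graph is known (`map_volume_graph`). The latter is obtained metrically: a small piece of a `C¹`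
graph is mapped to its tangent plane by a projection along `v` that is bi-Lipschitz with constants
close to 1. Arbitrary directions are combinations of transversal ones, and a partition of unity
handles functions vanishing near the singular part of the boundary. That part is compact and
`H^{d-1}`-null, so there are cutoffs around it whose gradients tend to 0 in `L¹`; they remove the
restriction in the limit. -/

open MeasureTheory Topology
open scoped Matrix

noncomputable section

set_option linter.unusedSectionVars false

namespace MFSBP

/-! ### Area of nearly flat sets and their projections. -/

section Flat

variable {E : Type*} [NormedAddCommGroup E] [InnerProductSpace ℝ E] [FiniteDimensional ℝ E]
  [MeasurableSpace E] [BorelSpace E]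

/-- Splitting of the space into the line spanned by a unit vector `v` and its orthogonal
complement. -/
def lineProd (v : E) (hv : ‖v‖ = 1) : ℝ × (ℝ ∙ v)ᗮ ≃ᵐ E :=
  ((LinearIsometryEquiv.toSpanUnitSingleton v hv).toHomeomorph.toMeasurableEquiv.prodCongr
    (MeasurableEquiv.refl _)).trans ((ℝ ∙ v).measurableEquivProd (0 : E)).symm

theorem lineProd_apply (v : E) (hv : ‖v‖ = 1) (p : ℝ × (ℝ ∙ v)ᗮ) :
    lineProd v hv p = p.1 • v + (p.2 : E) := by
  simp [lineProd, MeasurableEquiv.prodCongr]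

theorem measurePreserving_lineProd (v : E) (hv : ‖v‖ = 1) :
    MeasurePreserving (lineProd v hv) (volume.prod volume) volume := by
  have h1 : MeasurePreserving (LinearIsometryEquiv.toSpanUnitSingleton v hv) volume volume :=
    LinearIsometryEquiv.measurePreserving _
  have h2 := h1.prod (MeasurePreserving.id (volume : Measure (ℝ ∙ v)ᗮ))
  have h3 := ((ℝ ∙ v).measurePreserving_measurableEquivProd (0 : E)).symm
  rw [InnerProductSpace.euclideanHausdorffMeasure_eq_volume] at h3
  exact h3.comp h2

theorem integral_eq_integral_lines {v : E} (hv : ‖v‖ = 1) {f : E → ℝ} (hf : Integrable f) :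
    ∫ x, f x = ∫ y : (ℝ ∙ v)ᗮ, ∫ t : ℝ, f (t • v + (y : E)) := by
  have hm := measurePreserving_lineProd v hv
  have hme := (lineProd v hv).measurableEmbedding
  rw [← hm.integral_comp hme]
  have hi : Integrable (fun p => f (lineProd v hv p)) (volume.prod volume) :=
    (hm.integrable_comp_emb hme).2 hf
  rw [integral_prod_symm _ hi]
  simp only [lineProd_apply]

theorem coe_orthogonalProjectionOnto_orthogonal {v : E} (hv : ‖v‖ = 1) (x : E) :
    (((ℝ ∙ v)ᗮ.orthogonalProjectionOnto x : (ℝ ∙ v)ᗮ) : E) = x - (inner ℝ v x) • v := by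
  have h := (ℝ ∙ v).starProjection_add_starProjection_orthogonal x
  rw [Submodule.starProjection_unit_singleton ℝ hv x] at h
  rw [Submodule.coe_orthogonalProjectionOnto_apply]
  exact eq_sub_of_add_eq' h

/-- The parametrisation over `(ℝ ∙ v)ᗮ` of the hyperplane orthogonal to `n`. -/
def hyperplaneGraph (v n : E) : (ℝ ∙ v)ᗮ →ₗ[ℝ] E :=
  (ℝ ∙ v)ᗮ.subtype - (((inner ℝ v n)⁻¹ • (innerₗ E n)).comp (ℝ ∙ v)ᗮ.subtype).smulRight v

theorem hyperplaneGraph_apply (v n : E) (y : (ℝ ∙ v)ᗮ) :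
    hyperplaneGraph v n y = y - ((inner ℝ v n)⁻¹ * inner ℝ n (y : E)) • v := by
  simp [hyperplaneGraph]

/-- The projection along `v` onto the hyperplane orthogonal to `n` depends only on the orthogonal
projection along `v`, so it factors through `hyperplaneGraph`. -/
theorem hyperplaneGraph_orthogonalProjectionOnto {v n : E} (hv : ‖v‖ = 1) (hc : inner ℝ v n ≠ 0)
    (x : E) : hyperplaneGraph v n ((ℝ ∙ v)ᗮ.orthogonalProjectionOnto x)
      = x - ((inner ℝ v n)⁻¹ * inner ℝ n x) • v := by
  rw [hyperplaneGraph_apply, coe_orthogonalProjectionOnto_orthogonal hv, inner_sub_right,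
    inner_smul_right, real_inner_comm v n, sub_sub, ← add_smul]
  congr 2
  field_simp
  ring

/-- With `c = ⟨v, n⟩`, the Gram operator is the identity plus a rank-one term built from the
projection of `n`, whose squared length is `1 - c²`. Its determinant is therefore `1 + (1 - c²)/c² =
c⁻²`. -/
theorem normDet_hyperplaneGraph {v n : E} (hv : ‖v‖ = 1) (hn : ‖n‖ = 1) (hc : 0 < inner ℝ v n) :
    (hyperplaneGraph v n).normDet = (inner ℝ v n)⁻¹ := by
  have hadj : (hyperplaneGraph v n).adjoint ∘ₗ hyperplaneGraph v n
      = LinearMap.transvection ((inner ℝ v n : ℝ)⁻¹ • (innerₗ E n).comp (ℝ ∙ v)ᗮ.subtype)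
        ((inner ℝ v n : ℝ)⁻¹ • (ℝ ∙ v)ᗮ.orthogonalProjectionOnto n) := by
    refine LinearMap.ext fun y => ext_inner_left ℝ fun z => ?_
    have hy : inner ℝ v (y : E) = 0 := Submodule.mem_orthogonal_singleton_iff_inner_right.1 y.2
    have hz : inner ℝ v (z : E) = 0 := Submodule.mem_orthogonal_singleton_iff_inner_right.1 z.2
    have hz' : inner ℝ (z : E) v = 0 := Submodule.mem_orthogonal_singleton_iff_inner_left.1 z.2
    rw [LinearMap.comp_apply, LinearMap.adjoint_inner_right, LinearMap.transvection.apply,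
      hyperplaneGraph_apply, hyperplaneGraph_apply]
    simp only [inner_sub_left, inner_sub_right, inner_add_right, inner_smul_left, inner_smul_right,
      hy, hz', Submodule.coe_inner, LinearMap.smul_apply, LinearMap.comp_apply,
      Submodule.subtype_apply, innerₗ_apply_apply,
      coe_orthogonalProjectionOnto_orthogonal hv, real_inner_self_eq_norm_sq, hv,
      real_inner_comm (z : E) n]
    simp
  have hsq : (hyperplaneGraph v n).normDet ^ 2 = ((inner ℝ v n : ℝ)⁻¹) ^ 2 := by
    have := (hyperplaneGraph v n).normDet_sq
    rw [hadj, LinearMap.transvection.det] at this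
    simp only [RCLike.ofReal_real_eq_id, id_eq] at this
    rw [this]
    simp only [LinearMap.smul_apply, LinearMap.comp_apply, map_smul, Submodule.subtype_apply,
      innerₗ_apply_apply, coe_orthogonalProjectionOnto_orthogonal hv, inner_sub_right,
      real_inner_self_eq_norm_sq, hn, inner_smul_right, real_inner_comm v n, smul_eq_mul]
    field_simp
    ring
  exact (pow_left_inj₀ (LinearMap.normDet_nonneg _) (by positivity) two_ne_zero).1 hsq

theorem finrank_orthogonal_singleton {v : E} (hv : ‖v‖ = 1) :
    Module.finrank ℝ (ℝ ∙ v)ᗮ = Module.finrank ℝ E - 1 := by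
  have h := (ℝ ∙ v).finrank_add_finrank_orthogonal
  rw [finrank_span_singleton (by rintro rfl; simp at hv)] at h
  omega

theorem lipschitzOnWith_euclideanHausdorffMeasure_image_le {X Y : Type*} [EMetricSpace X]
    [MeasurableSpace X] [BorelSpace X] [EMetricSpace Y] [MeasurableSpace Y] [BorelSpace Y]
    {K : NNReal} {f : X → Y} {s : Set X} (h : LipschitzOnWith K f s) (m : ℕ) :
    μHE[m] (f '' s) ≤ (K : ENNReal) ^ m * μHE[m] s := by
  simp_rw [Measure.euclideanHausdorffMeasure_def, Measure.smul_apply, ENNReal.smul_def,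
    smul_eq_mul]
  rw [mul_left_comm]
  gcongr
  simpa using h.hausdorffMeasure_image_le (d := m) (by positivity)

/-- A set that is almost contained in a hyperplane has almost the area of its projection, divided
by the cosine of the angle. -/
theorem area_comparison {v n : E} (hv : ‖v‖ = 1) (hn : ‖n‖ = 1) (hc : 0 < inner ℝ v n)
    {δ : NNReal} (hδ : δ < 1) {A : Set E}
    (hA : ∀ p ∈ A, ∀ q ∈ A, |inner ℝ n (p - q)| ≤ δ * inner ℝ v n * ‖p - q‖) :
    volume ((ℝ ∙ v)ᗮ.orthogonalProjectionOnto '' A) ≤ ((1 + δ : NNReal) : ENNReal)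
        ^ (Module.finrank ℝ E - 1)
        * (ENNReal.ofReal (inner ℝ v n) * μHE[Module.finrank ℝ E - 1] A) ∧
    ENNReal.ofReal (inner ℝ v n) * μHE[Module.finrank ℝ E - 1] A ≤
      (((1 - δ)⁻¹ : NNReal) : ENNReal) ^ (Module.finrank ℝ E - 1) *
        volume ((ℝ ∙ v)ᗮ.orthogonalProjectionOnto '' A) := by
  set m := Module.finrank ℝ E - 1 with hm
  set π := (ℝ ∙ v)ᗮ.orthogonalProjectionOnto with hπ
  set c : ℝ := inner ℝ v n with hcdef
  -- `P` projects along `v` onto the hyperplane orthogonal to `n`. On differences of points of `A`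
  -- it deviates from the identity by at most the factor `δ`; the cosine in the flatness hypothesis
  -- cancels the division by `c`. So `P` and its inverse on `A` are Lipschitz with constants `1 + δ`
  -- and `(1 - δ)⁻¹`, while for the flat set `P '' A` the area is known exactly.
  set P : E → E := fun x => x - (c⁻¹ * inner ℝ n x) • v with hP
  have hsub : ∀ p q, P p - P q = (p - q) - (c⁻¹ * inner ℝ n (p - q)) • v := by
    intro p q
    simp only [hP, inner_sub_right, mul_sub, sub_smul]
    abel
  have hsm : ∀ p ∈ A, ∀ q ∈ A, ‖(c⁻¹ * inner ℝ n (p - q)) • v‖ ≤ δ * ‖p - q‖ := by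
    intro p hp q hq
    rw [norm_smul, hv, mul_one, norm_mul, Real.norm_eq_abs, Real.norm_eq_abs,
      abs_of_pos (inv_pos.2 hc)]
    calc c⁻¹ * |inner ℝ n (p - q)| ≤ c⁻¹ * (δ * c * ‖p - q‖) := by
          gcongr; exact hA p hp q hq
      _ = δ * ‖p - q‖ := by field_simp
  have himg : P '' A = hyperplaneGraph v n '' (π '' A) := by
    rw [Set.image_image]
    refine Set.image_congr fun x _ => ?_
    rw [hyperplaneGraph_orthogonalProjectionOnto hv hc.ne']
  have hvol : volume (π '' A) = ENNReal.ofReal c * μHE[m] (P '' A) := by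
    have := (hyperplaneGraph v n).euclideanHausdorffMeasure_image_eq_normDet_mul_volume (π '' A)
    rw [finrank_orthogonal_singleton hv, normDet_hyperplaneGraph hv hn hc] at this
    rw [himg, this, ← mul_assoc, ← ENNReal.ofReal_mul hc.le, mul_inv_cancel₀ hc.ne']
    simp
  have hL1 : LipschitzOnWith (1 + δ) P A := by
    refine LipschitzOnWith.of_dist_le_mul fun p hp q hq => ?_
    rw [dist_eq_norm, dist_eq_norm, hsub]
    refine (norm_sub_le _ _).trans ?_
    have := hsm p hp q hq
    push_cast
    linarith
  have hL2 : ∀ p ∈ A, ∀ q ∈ A, dist p q ≤ ((1 - δ)⁻¹ : NNReal) * dist (P p) (P q) := by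
    intro p hp q hq
    have h1 : (0 : ℝ) < 1 - δ := sub_pos.2 (by exact_mod_cast hδ)
    rw [NNReal.coe_inv, NNReal.coe_sub hδ.le, NNReal.coe_one, ← div_eq_inv_mul, le_div_iff₀ h1,
      dist_eq_norm, dist_eq_norm, hsub]
    have := hsm p hp q hq
    have := norm_sub_norm_le (p - q) ((c⁻¹ * inner ℝ n (p - q)) • v)
    linarith
  have hinj : Set.InjOn P A := by
    intro p hp q hq h
    have := hL2 p hp q hq
    rw [h, dist_self, mul_zero] at this
    exact dist_le_zero.1 this
  have hL3 : LipschitzOnWith (1 - δ)⁻¹ (Function.invFunOn P A) (P '' A) := by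
    refine LipschitzOnWith.of_dist_le_mul ?_
    rintro _ ⟨p, hp, rfl⟩ _ ⟨q, hq, rfl⟩
    rw [hinj.leftInvOn_invFunOn hp, hinj.leftInvOn_invFunOn hq]
    exact hL2 p hp q hq
  constructor
  · rw [hvol, mul_left_comm]
    gcongr
    exact lipschitzOnWith_euclideanHausdorffMeasure_image_le hL1 m
  · rw [hvol, mul_left_comm]
    gcongr
    have := lipschitzOnWith_euclideanHausdorffMeasure_image_le hL3 m
    rwa [hinj.leftInvOn_invFunOn.image_image] at this

end Flat
end MFSBP

/-! ### Area element of a `C¹` graph. -/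

namespace MFSBP

theorem ennreal_le_of_forall_one_lt_le_mul {a b : ENNReal}
    (h : ∀ C : NNReal, 1 < C → a ≤ C * b) : a ≤ b := by
  have h1 : Filter.Tendsto (fun C : NNReal => (C : ENNReal) * b) (𝓝[>] 1) (𝓝 (1 * b)) := by
    refine ENNReal.Tendsto.mul_const ?_ (Or.inl one_ne_zero)
    exact (ENNReal.continuous_coe.tendsto 1).mono_left nhdsWithin_le_nhds
  rw [one_mul] at h1
  exact ge_of_tendsto h1 (by filter_upwards [self_mem_nhdsWithin] with C hC using h C hC)

/-- Inequalities between measures are local. -/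
theorem measure_le_of_forall_nhdsWithin {X : Type*} [TopologicalSpace X]
    [SecondCountableTopology X] [MeasurableSpace X] [OpensMeasurableSpace X] {μ ν : Measure X}
    {S : Set X} (h : ∀ x ∈ S, ∃ V ∈ 𝓝[S] x, ∀ A ⊆ V ∩ S, MeasurableSet A → μ A ≤ ν A)
    {A : Set X} (hA : MeasurableSet A) (hAS : A ⊆ S) : μ A ≤ ν A := by
  have h' : ∀ x : X, ∃ U : Set X, IsOpen U ∧ (x ∈ S → x ∈ U) ∧
      ∀ A ⊆ U ∩ S, MeasurableSet A → μ A ≤ ν A := by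
    intro x
    by_cases hx : x ∈ S
    · obtain ⟨V, hV, hVA⟩ := h x hx
      obtain ⟨U, hU, hxU, hUV⟩ := mem_nhdsWithin.1 hV
      exact ⟨U, hU, fun _ => hxU, fun A hA => hVA A fun y hy => ⟨hUV (hA hy), (hA hy).2⟩⟩
    · exact ⟨∅, isOpen_empty, fun h => absurd h hx, fun A hA _ => by
        have : A = ∅ := Set.subset_eq_empty (by simpa using hA) rfl
        simp [this]⟩
  choose U hUo hxU hU using h'
  obtain ⟨T, -, hTc, hST⟩ := TopologicalSpace.countable_cover_nhdsWithin (f := U) (s := S)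
    fun x hx => mem_nhdsWithin_of_mem_nhds ((hUo x).mem_nhds (hxU x hx))
  rcases T.eq_empty_or_nonempty with rfl | hTn
  · have : A = ∅ := Set.subset_eq_empty (hAS.trans hST) (by simp)
    simp [this]
  obtain ⟨e, rfl⟩ := hTc.exists_eq_range hTn
  -- Making the countable cover disjoint lets the local inequalities be summed without overcounting.
  have hdm : ∀ k, MeasurableSet (disjointed (fun k => U (e k)) k) :=
    fun k => MeasurableSet.disjointed (fun k => (hUo (e k)).measurableSet) k
  have hAeq : A = ⋃ k, A ∩ disjointed (fun k => U (e k)) k := by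
    rw [← Set.inter_iUnion, iUnion_disjointed, eq_comm, Set.inter_eq_left]
    simpa using hAS.trans hST
  have hdisj : Pairwise (Function.onFun Disjoint fun k => A ∩ disjointed (fun k => U (e k)) k) :=
    fun i j hij => (disjoint_disjointed (fun k => U (e k)) hij).mono Set.inter_subset_right
      Set.inter_subset_right
  rw [hAeq, measure_iUnion hdisj fun k => hA.inter (hdm k),
    measure_iUnion hdisj fun k => hA.inter (hdm k)]
  exact ENNReal.tsum_le_tsum fun k => hU (e k) _
    (fun y hy => ⟨disjointed_subset (fun k => U (e k)) k hy.2, hAS hy.1⟩) (hA.inter (hdm k))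

section Graph

variable {E : Type*} [NormedAddCommGroup E] [InnerProductSpace ℝ E] [FiniteDimensional ℝ E]
  [MeasurableSpace E] [BorelSpace E]

theorem exists_delta (m : ℕ) {C : NNReal} (hC : 1 < C) :
    ∃ δ : NNReal, 0 < δ ∧ δ < 1 ∧ (1 + δ) ^ m ≤ C ∧ ((1 - δ)⁻¹) ^ m ≤ C := by
  have h1 : Filter.Tendsto (fun δ : NNReal => (1 + δ) ^ m) (𝓝[>] 0) (𝓝 1) := by
    have : Continuous (fun δ : NNReal => (1 + δ) ^ m) := by fun_prop
    simpa using (this.tendsto 0).mono_left nhdsWithin_le_nhds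
  have h2 : Filter.Tendsto (fun δ : NNReal => ((1 - δ)⁻¹) ^ m) (𝓝[>] 0) (𝓝 1) := by
    have : ContinuousAt (fun δ : NNReal => ((1 - δ)⁻¹) ^ m) 0 := by
      refine ContinuousAt.pow (ContinuousAt.inv₀ ?_ (by simp)) m
      exact (continuous_const.sub continuous_id).continuousAt
    simpa [ContinuousAt] using this.tendsto.mono_left (nhdsWithin_le_nhds (s := Set.Ioi 0))
  have h3 : ∀ᶠ δ : NNReal in 𝓝[>] 0, δ < 1 :=
    mem_nhdsWithin_of_mem_nhds (Iio_mem_nhds one_pos)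
  obtain ⟨δ, hδ⟩ := ((h1.eventually_le_const hC).and ((h2.eventually_le_const hC).and
    (h3.and self_mem_nhdsWithin))).exists
  exact ⟨δ, hδ.2.2.2, hδ.2.2.1, hδ.1, hδ.2.1⟩

/-- The area element of a `C¹` graph over the hyperplane orthogonal to `v`: the Lebesgue measure of
the hyperplane corresponds to the surface measure, multiplied by the cosine of the angle between
`v` and the unit normal `n`. -/
theorem map_volume_graph {v : E} (hv : ‖v‖ = 1) {M : Set E} (hM : MeasurableSet M)
    {S : Set (ℝ ∙ v)ᗮ} {G : (ℝ ∙ v)ᗮ → E}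
    (hG : Measurable G) (hGM : ∀ y ∈ S, G y ∈ M ∧ (ℝ ∙ v)ᗮ.orthogonalProjectionOnto (G y) = y)
    (hMS : ∀ x ∈ M, (ℝ ∙ v)ᗮ.orthogonalProjectionOnto x ∈ S ∧
      G ((ℝ ∙ v)ᗮ.orthogonalProjectionOnto x) = x)
    {n : E → E} (hn : ∀ x ∈ M, ‖n x‖ = 1) (hc : ∀ x ∈ M, 0 < inner ℝ v (n x))
    (hcont : ContinuousOn n M)
    (hflat : ∀ p ∈ M, ∀ η > 0, ∃ V ∈ 𝓝[M] p, ∀ x ∈ V, ∀ y ∈ V,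
      |inner ℝ (n p) (x - y)| ≤ η * ‖x - y‖) :
    (volume.restrict S).map G = (μHE[Module.finrank ℝ E - 1].restrict M).withDensity
      (fun x => ENNReal.ofReal (inner ℝ v (n x))) := by
  set μ := (volume.restrict S).map G with hμ
  set ν := (μHE[Module.finrank ℝ E - 1].restrict M).withDensity
      (fun x => ENNReal.ofReal (inner ℝ v (n x))) with hν
  -- The projection inverts `G` on `M`, so the pushforward measures a set by the volume of its
  -- shadow, which is what `area_comparison` controls.
  have hμA : ∀ A ⊆ M, MeasurableSet A →
      μ A = volume ((ℝ ∙ v)ᗮ.orthogonalProjectionOnto '' A) := by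
    intro A hAM hA
    rw [hμ, Measure.map_apply hG hA, Measure.restrict_apply (hG hA)]
    congr 1
    ext y
    constructor
    · rintro ⟨h1, h2⟩
      exact ⟨G y, h1, (hGM y h2).2⟩
    · rintro ⟨x, hx, rfl⟩
      exact ⟨by rw [Set.mem_preimage, (hMS x (hAM hx)).2]; exact hx, (hMS x (hAM hx)).1⟩
  have hνA : ∀ A ⊆ M, MeasurableSet A →
      ν A = ∫⁻ x in A, ENNReal.ofReal (inner ℝ v (n x)) ∂μHE[Module.finrank ℝ E - 1] := by
    intro A hAM hA
    rw [hν, withDensity_apply _ hA, Measure.restrict_restrict hA, Set.inter_eq_left.2 hAM]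
  have hloc : ∀ C : NNReal, 1 < C → ∀ p ∈ M, ∃ V ∈ 𝓝[M] p, ∀ A ⊆ V ∩ M, MeasurableSet A →
      μ A ≤ C * ν A ∧ ν A ≤ C * μ A := by
    intro C hC p hp
    -- There are two sources of error, the metric distortion of the projection and the oscillation
    -- of the cosine. Each is allowed a factor `D`.
    obtain ⟨D, hD1, hDC⟩ : ∃ D : NNReal, 1 < D ∧ D * D ≤ C := by
      refine ⟨NNReal.sqrt C, ?_, by simp⟩
      simpa using NNReal.sqrt_lt_sqrt.2 hC
    obtain ⟨δ, hδ0, hδ1, hδD1, hδD2⟩ := exists_delta (Module.finrank ℝ E - 1) hD1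
    have hcp := hc p hp
    obtain ⟨V₁, hV₁, hflatV⟩ := hflat p hp (δ * inner ℝ v (n p)) (by positivity)
    have hcc : ContinuousWithinAt (fun x => inner ℝ v (n x)) M p :=
      continuousWithinAt_const.inner (hcont p hp)
    have hD0 : (0 : ℝ) < D := by positivity
    have hD1' : (1 : ℝ) < D := by exact_mod_cast hD1
    have h1 : ∀ᶠ x in 𝓝[M] p, inner ℝ v (n x) < D * inner ℝ v (n p) :=
      hcc.eventually_lt_const (by nlinarith)
    have h2 : ∀ᶠ x in 𝓝[M] p, (D : ℝ)⁻¹ * inner ℝ v (n p) < inner ℝ v (n x) :=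
      hcc.eventually_const_lt (by
        have := inv_lt_one_of_one_lt₀ hD1'
        nlinarith)
    refine ⟨V₁ ∩ {x | inner ℝ v (n x) < D * inner ℝ v (n p) ∧
      (D : ℝ)⁻¹ * inner ℝ v (n p) < inner ℝ v (n x)}, Filter.inter_mem hV₁ (h1.and h2), ?_⟩
    intro A hA hAm
    have hAM : A ⊆ M := fun x hx => (hA hx).2
    obtain ⟨ha1, ha2⟩ := area_comparison hv (hn p hp) hcp hδ1 (A := A)
      fun x hx y hy => hflatV x (hA hx).1.1 y (hA hy).1.1
    rw [← hμA A hAM hAm, ← ENNReal.coe_pow] at ha1 ha2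
    have hup : ν A ≤ D * (ENNReal.ofReal (inner ℝ v (n p)) * μHE[Module.finrank ℝ E - 1] A) := by
      rw [hνA A hAM hAm, ← mul_assoc, ← ENNReal.ofReal_coe_nnreal, ← ENNReal.ofReal_mul hD0.le,
        ← setLIntegral_const]
      exact setLIntegral_mono' hAm fun x hx => ENNReal.ofReal_le_ofReal (hA hx).1.2.1.le
    have hlow : ENNReal.ofReal (inner ℝ v (n p)) * μHE[Module.finrank ℝ E - 1] A ≤ D * ν A := by
      have : ENNReal.ofReal ((D : ℝ)⁻¹ * inner ℝ v (n p)) * μHE[Module.finrank ℝ E - 1] A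
          ≤ ν A := by
        rw [hνA A hAM hAm, ← setLIntegral_const]
        exact setLIntegral_mono' hAm fun x hx => ENNReal.ofReal_le_ofReal (hA hx).1.2.2.le
      calc _ = (D : ENNReal) * (ENNReal.ofReal ((D : ℝ)⁻¹ * inner ℝ v (n p))
            * μHE[Module.finrank ℝ E - 1] A) := by
            rw [← mul_assoc]
            congr 1
            rw [← ENNReal.ofReal_coe_nnreal, ← ENNReal.ofReal_mul hD0.le,
              mul_inv_cancel_left₀ hD0.ne']
        _ ≤ _ := by gcongr
    have hDC' : (D : ENNReal) * D ≤ C := by exact_mod_cast hDC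
    constructor
    · calc μ A ≤ D * (ENNReal.ofReal (inner ℝ v (n p)) * μHE[Module.finrank ℝ E - 1] A) :=
            ha1.trans (by gcongr)
        _ ≤ D * (D * ν A) := by gcongr
        _ = (D * D) * ν A := by ring
        _ ≤ C * ν A := by gcongr
    · calc ν A ≤ D * (ENNReal.ofReal (inner ℝ v (n p)) * μHE[Module.finrank ℝ E - 1] A) := hup
        _ ≤ D * (D * μ A) := mul_le_mul' le_rfl (ha2.trans (by gcongr))
        _ = (D * D) * μ A := by ring
        _ ≤ C * μ A := by gcongr
  have hμM : ∀ A, MeasurableSet A → μ A = μ (A ∩ M) := by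
    intro A hA
    rw [hμ, Measure.map_apply hG hA, Measure.map_apply hG (hA.inter hM),
      Measure.restrict_apply (hG hA), Measure.restrict_apply (hG (hA.inter hM))]
    congr 1
    ext y
    simp only [Set.mem_inter_iff, Set.mem_preimage]
    exact ⟨fun h => ⟨⟨h.1, (hGM y h.2).1⟩, h.2⟩, fun h => ⟨h.1.1, h.2⟩⟩
  have hνM : ∀ A, MeasurableSet A → ν A = ν (A ∩ M) := by
    intro A hA
    rw [hν, withDensity_apply _ hA, withDensity_apply _ (hA.inter hM),
      Measure.restrict_restrict hA, Measure.restrict_restrict (hA.inter hM), Set.inter_assoc,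
      Set.inter_self]
  refine Measure.ext fun A hA => ?_
  rw [hμM A hA, hνM A hA]
  -- The local comparison with constant `C` passes to all of `M`, and then `C` tends to 1.
  refine le_antisymm (ennreal_le_of_forall_one_lt_le_mul fun C hC => ?_)
    (ennreal_le_of_forall_one_lt_le_mul fun C hC => ?_)
  · change μ (A ∩ M) ≤ ((C : ENNReal) • ν) (A ∩ M)
    refine measure_le_of_forall_nhdsWithin (fun p hp => ?_) (hA.inter hM) Set.inter_subset_right
    obtain ⟨V, hV, h⟩ := hloc C hC p hp
    exact ⟨V, hV, fun A hA hAm => (h A hA hAm).1⟩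
  · change ν (A ∩ M) ≤ ((C : ENNReal) • μ) (A ∩ M)
    refine measure_le_of_forall_nhdsWithin (fun p hp => ?_) (hA.inter hM) Set.inter_subset_right
    obtain ⟨V, hV, h⟩ := hloc C hC p hp
    exact ⟨V, hV, fun A hA hAm => (h A hA hAm).2⟩

end Graph
end MFSBP

/-! ### The smooth boundary as a graph. -/

namespace MFSBP

variable {d : ℕ}

theorem IsDefiningFunctionAt.continuousAt_gradient {Ω : Set (EuclideanSpace ℝ (Fin d))}
    {ρ : EuclideanSpace ℝ (Fin d) → ℝ} {p : EuclideanSpace ℝ (Fin d)}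
    (h : IsDefiningFunctionAt Ω ρ p) : ContinuousAt (gradient ρ) p :=
  (InnerProductSpace.toDual ℝ _).symm.continuous.continuousAt.comp
    (h.contDiffAt.continuousAt_fderiv (by norm_num))

theorem IsDefiningFunctionAt.eventually {Ω : Set (EuclideanSpace ℝ (Fin d))}
    {ρ : EuclideanSpace ℝ (Fin d) → ℝ} {p : EuclideanSpace ℝ (Fin d)}
    (h : IsDefiningFunctionAt Ω ρ p) : ∀ᶠ q in 𝓝 p, IsDefiningFunctionAt Ω ρ q := by
  filter_upwards [h.contDiffAt.eventually (by simp), h.continuousAt_gradient.eventually_ne h.gradient_ne_zero,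
    h.eventually_mem_iff.eventually_nhds] with q h1 h2 h3 using ⟨h1, h2, h3⟩

theorem IsDefiningFunctionAt.hasDerivAt_line_at {Ω : Set (EuclideanSpace ℝ (Fin d))}
    {ρ : EuclideanSpace ℝ (Fin d) → ℝ} {v y : EuclideanSpace ℝ (Fin d)} {t : ℝ}
    (h : IsDefiningFunctionAt Ω ρ (t • v + y)) :
    HasDerivAt (fun s : ℝ => ρ (s • v + y)) (inner ℝ v (gradient ρ (t • v + y))) t := by
  have h1 : HasGradientAt ρ (gradient ρ (t • v + y)) (t • v + y) :=
    (h.contDiffAt.differentiableAt (by norm_num)).hasGradientAt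
  have h2 : HasDerivAt (fun t : ℝ => t • v + y) v t := by
    simpa using ((hasDerivAt_id t).smul_const v).add_const y
  rw [real_inner_comm]
  simpa [Function.comp_def] using h1.hasFDerivAt.comp_hasDerivAt t h2

/-- Near a smooth boundary point, and in a direction `v` pointing outwards, the set `Ω` is the
subgraph of a continuous function. -/
theorem IsDefiningFunctionAt.exists_subgraph {Ω : Set (EuclideanSpace ℝ (Fin d))} (hΩ : IsOpen Ω)
    {ρ : EuclideanSpace ℝ (Fin d) → ℝ} {p v : EuclideanSpace ℝ (Fin d)} (hp : p ∈ frontier Ω)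
    (h : IsDefiningFunctionAt Ω ρ p) (hv : ‖v‖ = 1) (hvp : 0 < inner ℝ v (gradient ρ p)) :
    ∃ (a₁ a₂ : ℝ) (S : Set (ℝ ∙ v)ᗮ) (γ : (ℝ ∙ v)ᗮ → ℝ), IsOpen S ∧
      (ℝ ∙ v)ᗮ.orthogonalProjectionOnto p ∈ S ∧ inner ℝ v p ∈ Set.Ioo a₁ a₂ ∧
      ContinuousOn γ S ∧ (∀ y ∈ S, γ y ∈ Set.Ioo a₁ a₂) ∧
      (∀ y ∈ S, ∀ t ∈ Set.Ioo a₁ a₂, (t • v + (y : EuclideanSpace ℝ (Fin d)) ∈ Ω ↔ t < γ y)) ∧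
      (∀ y ∈ S, ∀ t ∈ Set.Ioo a₁ a₂,
        (t • v + (y : EuclideanSpace ℝ (Fin d)) ∈ frontier Ω ↔ t = γ y)) ∧
      ∀ y ∈ S, IsDefiningFunctionAt Ω ρ (γ y • v + y) ∧
        0 < inner ℝ v (gradient ρ (γ y • v + (y : EuclideanSpace ℝ (Fin d)))) := by
  set y₀ := (ℝ ∙ v)ᗮ.orthogonalProjectionOnto p with hy₀
  set t₀ : ℝ := inner ℝ v p with ht₀
  have hpdec : t₀ • v + (y₀ : EuclideanSpace ℝ (Fin d)) = p := by
    rw [hy₀, coe_orthogonalProjectionOnto_orthogonal hv]; simp [ht₀]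
  have hev : ∀ᶠ q in 𝓝 p, IsDefiningFunctionAt Ω ρ q ∧ 0 < inner ℝ v (gradient ρ q) :=
    h.eventually.and ((continuousAt_const.inner h.continuousAt_gradient).eventually_const_lt hvp)
  have hcj : Continuous fun z : ℝ × (ℝ ∙ v)ᗮ => z.1 • v + (z.2 : EuclideanSpace ℝ (Fin d)) := by
    fun_prop
  have hev2 : ∀ᶠ z : ℝ × (ℝ ∙ v)ᗮ in 𝓝 (t₀, y₀), IsDefiningFunctionAt Ω ρ (z.1 • v + z.2) ∧
      0 < inner ℝ v (gradient ρ (z.1 • v + (z.2 : EuclideanSpace ℝ (Fin d)))) := by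
    have ht : Filter.Tendsto
        (fun z : ℝ × (ℝ ∙ v)ᗮ => z.1 • v + (z.2 : EuclideanSpace ℝ (Fin d)))
        (𝓝 (t₀, y₀)) (𝓝 p) := by
      simpa only [hpdec] using hcj.tendsto (t₀, y₀)
    exact ht.eventually hev
  obtain ⟨r, hr, hr2⟩ := Metric.eventually_nhds_iff.1 hev2
  have hball : ∀ t, |t - t₀| ≤ r / 2 → ∀ y : (ℝ ∙ v)ᗮ, dist y y₀ < r →
      IsDefiningFunctionAt Ω ρ (t • v + y) ∧
      0 < inner ℝ v (gradient ρ (t • v + (y : EuclideanSpace ℝ (Fin d)))) := by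
    intro t ht y hy
    refine hr2 (y := (t, y)) ?_
    rw [Prod.dist_eq, max_lt_iff]
    exact ⟨by rw [Real.dist_eq]; linarith, hy⟩
  have hder : ∀ t, |t - t₀| ≤ r / 2 → ∀ y : (ℝ ∙ v)ᗮ, dist y y₀ < r →
      HasDerivAt (fun s : ℝ => ρ (s • v + (y : EuclideanSpace ℝ (Fin d))))
        (inner ℝ v (gradient ρ (t • v + (y : EuclideanSpace ℝ (Fin d))))) t :=
    fun t ht y hy => (hball t ht y hy).1.hasDerivAt_line_at
  have hmem : ∀ t, t ∈ Set.Icc (t₀ - r / 2) (t₀ + r / 2) ↔ |t - t₀| ≤ r / 2 := by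
    intro t
    rw [abs_le, Set.mem_Icc]
    constructor <;> rintro ⟨h1, h2⟩ <;> constructor <;> linarith
  have hmono : ∀ y : (ℝ ∙ v)ᗮ, dist y y₀ < r →
      StrictMonoOn (fun s : ℝ => ρ (s • v + (y : EuclideanSpace ℝ (Fin d))))
        (Set.Icc (t₀ - r / 2) (t₀ + r / 2)) := by
    intro y hy
    refine strictMonoOn_of_deriv_pos (convex_Icc _ _) (fun t ht => ?_) fun t ht => ?_
    · exact (hder t ((hmem t).1 ht) y hy).continuousAt.continuousWithinAt
    · have ht' := (hmem t).1 (interior_subset ht)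
      rw [(hder t ht' y hy).deriv]
      exact (hball t ht' y hy).2
  have hρ0 : ρ (t₀ • v + (y₀ : EuclideanSpace ℝ (Fin d))) = 0 := by
    rw [hpdec]; exact h.apply_eq_zero hp hΩ
  have hcy : ∀ t, |t - t₀| ≤ r / 2 → ∀ y : (ℝ ∙ v)ᗮ, dist y y₀ < r →
      ContinuousAt (fun y : (ℝ ∙ v)ᗮ => ρ (t • v + (y : EuclideanSpace ℝ (Fin d)))) y := by
    intro t ht y hy
    have h1 := (hball t ht y hy).1.contDiffAt.continuousAt
    exact ContinuousAt.comp (g := ρ)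
      (f := fun y : (ℝ ∙ v)ᗮ => t • v + (y : EuclideanSpace ℝ (Fin d))) h1 (by fun_prop)
  have hl : |(t₀ - r / 2) - t₀| ≤ r / 2 := by rw [abs_le]; constructor <;> linarith
  have hu : |(t₀ + r / 2) - t₀| ≤ r / 2 := by rw [abs_le]; constructor <;> linarith
  have hm0 : |t₀ - t₀| ≤ r / 2 := by rw [abs_le]; constructor <;> linarith
  have hy0r : dist y₀ y₀ < r := by simpa using hr
  have hneg : ρ ((t₀ - r / 2) • v + (y₀ : EuclideanSpace ℝ (Fin d))) < 0 := by
    rw [← hρ0]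
    exact hmono y₀ hy0r ((hmem _).2 hl) ((hmem _).2 hm0) (by linarith)
  have hpos : 0 < ρ ((t₀ + r / 2) • v + (y₀ : EuclideanSpace ℝ (Fin d))) := by
    rw [← hρ0]
    exact hmono y₀ hy0r ((hmem _).2 hm0) ((hmem _).2 hu) (by linarith)
  -- The height interval is fixed first, and only then is the base shrunk, so that `ρ` stays
  -- negative at the bottom and positive at the top of every line over `S`. Strict monotonicity on
  -- each line then yields exactly one zero, `γ y`.
  obtain ⟨b, hb, hb2⟩ := Metric.eventually_nhds_iff.1
    (((hcy _ hl y₀ hy0r).eventually_lt_const hneg).and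
      ((hcy _ hu y₀ hy0r).eventually_const_lt hpos))
  set S := Metric.ball y₀ (min b r) with hS
  have hSr : ∀ y ∈ S, dist y y₀ < r := fun y hy => lt_of_lt_of_le hy (min_le_right _ _)
  have hSb : ∀ y ∈ S, dist y y₀ < b := fun y hy => lt_of_lt_of_le hy (min_le_left _ _)
  have hγ : ∀ y : (ℝ ∙ v)ᗮ, ∃ t, y ∈ S → t ∈ Set.Ioo (t₀ - r / 2) (t₀ + r / 2) ∧
      ρ (t • v + (y : EuclideanSpace ℝ (Fin d))) = 0 := by
    intro y
    by_cases hy : y ∈ S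
    · have hcont : ContinuousOn (fun s : ℝ => ρ (s • v + (y : EuclideanSpace ℝ (Fin d))))
          (Set.Icc (t₀ - r / 2) (t₀ + r / 2)) := fun t ht =>
        (hder t ((hmem t).1 ht) y (hSr y hy)).continuousAt.continuousWithinAt
      obtain ⟨t, ht, ht0⟩ := intermediate_value_Ioo (by linarith) hcont
        (show (0 : ℝ) ∈ Set.Ioo _ _ from hb2 (hSb y hy))
      exact ⟨t, fun _ => ⟨ht, ht0⟩⟩
    · exact ⟨0, fun h => absurd h hy⟩
  choose γ hγ using hγ
  have hIoo : ∀ t ∈ Set.Ioo (t₀ - r / 2) (t₀ + r / 2), |t - t₀| ≤ r / 2 :=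
    fun t ht => (hmem t).1 (Set.Ioo_subset_Icc_self ht)
  have hlt : ∀ y ∈ S, ∀ t ∈ Set.Ioo (t₀ - r / 2) (t₀ + r / 2),
      (ρ (t • v + (y : EuclideanSpace ℝ (Fin d))) < 0 ↔ t < γ y) := by
    intro y hy t ht
    rw [← (hγ y hy).2]
    exact (hmono y (hSr y hy)).lt_iff_lt (Set.Ioo_subset_Icc_self ht)
      (Set.Ioo_subset_Icc_self (hγ y hy).1)
  have hgt : ∀ y ∈ S, ∀ t ∈ Set.Ioo (t₀ - r / 2) (t₀ + r / 2),
      (0 < ρ (t • v + (y : EuclideanSpace ℝ (Fin d))) ↔ γ y < t) := by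
    intro y hy t ht
    rw [← (hγ y hy).2]
    exact (hmono y (hSr y hy)).lt_iff_lt (Set.Ioo_subset_Icc_self (hγ y hy).1)
      (Set.Ioo_subset_Icc_self ht)
  have hΩiff : ∀ y ∈ S, ∀ t ∈ Set.Ioo (t₀ - r / 2) (t₀ + r / 2),
      (t • v + (y : EuclideanSpace ℝ (Fin d)) ∈ Ω ↔ t < γ y) := by
    intro y hy t ht
    rw [← hlt y hy t ht]
    exact (hball t (hIoo t ht) y (hSr y hy)).1.eventually_mem_iff.self_of_nhds
  refine ⟨t₀ - r / 2, t₀ + r / 2, S, γ, Metric.isOpen_ball,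
    Metric.mem_ball_self (lt_min hb hr), ⟨by linarith, by linarith⟩, ?_,
    fun y hy => (hγ y hy).1, hΩiff, ?_,
    fun y hy => hball _ (hIoo _ (hγ y hy).1) y (hSr y hy)⟩
  · intro y hy
    refine ContinuousAt.continuousWithinAt ?_
    have hSn : ∀ᶠ y' in 𝓝 y, y' ∈ S := Metric.isOpen_ball.mem_nhds hy
    have hγy := (hγ y hy).1
    -- Continuity of `γ`: the sign of `ρ` at a height `s'` strictly between `s` and `γ y` persists
    -- for nearby base points, and it tells on which side of `s'` their zero lies.
    refine tendsto_order.2 ⟨fun s hs => ?_, fun s hs => ?_⟩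
    · obtain ⟨s', hs1, hs2⟩ := exists_between (max_lt hs hγy.1)
      have hs' : s' ∈ Set.Ioo (t₀ - r / 2) (t₀ + r / 2) :=
        ⟨(le_max_right _ _).trans_lt hs1, hs2.trans hγy.2⟩
      filter_upwards [hSn, (hcy s' (hIoo _ hs') y (hSr y hy)).eventually_lt_const
        ((hlt y hy s' hs').2 hs2)] with y' h1 h2
      exact ((le_max_left _ _).trans_lt hs1).trans ((hlt y' h1 s' hs').1 h2)
    · obtain ⟨s', hs1, hs2⟩ := exists_between (lt_min hs hγy.2)
      have hs' : s' ∈ Set.Ioo (t₀ - r / 2) (t₀ + r / 2) :=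
        ⟨hγy.1.trans hs1, hs2.trans_le (min_le_right _ _)⟩
      filter_upwards [hSn, (hcy s' (hIoo _ hs') y (hSr y hy)).eventually_const_lt
        ((hgt y hy s' hs').2 hs1)] with y' h1 h2
      exact ((hgt y' h1 s' hs').1 h2).trans (hs2.trans_le (min_le_left _ _))
  · intro y hy t ht
    constructor
    · intro hfr
      have h0 := (hball t (hIoo t ht) y (hSr y hy)).1.apply_eq_zero hfr hΩ
      have h1 := hlt y hy t ht
      have h2 := hgt y hy t ht
      rw [h0] at h1 h2
      exact le_antisymm (not_lt.1 fun h => lt_irrefl _ (h2.2 h))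
        (not_lt.1 fun h => lt_irrefl _ (h1.2 h))
    · rintro rfl
      rw [hΩ.frontier_eq]
      refine ⟨?_, fun h => lt_irrefl _ ((hΩiff y hy _ ht).1 h)⟩
      have hc : Continuous fun t : ℝ => t • v + (y : EuclideanSpace ℝ (Fin d)) := by fun_prop
      refine mem_closure_of_tendsto (b := 𝓝[<] (γ y))
        ((hc.tendsto (γ y)).mono_left nhdsWithin_le_nhds) ?_
      filter_upwards [self_mem_nhdsWithin, mem_nhdsWithin_of_mem_nhds (isOpen_Ioo.mem_nhds ht)]
        with s hs1 hs2 using (hΩiff y hy s hs2).2 hs1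

end MFSBP

/-! ### The divergence theorem near a smooth boundary point. -/

namespace MFSBP

variable {d : ℕ}

theorem integrableOn_of_continuousOn_closure {Ω : Set (EuclideanSpace ℝ (Fin d))}
    (hΩb : Bornology.IsBounded Ω) {f : EuclideanSpace ℝ (Fin d) → ℝ}
    (hf : ContinuousOn f (closure Ω)) : IntegrableOn f Ω :=
  (hf.integrableOn_compact hΩb.isCompact_closure).mono_set subset_closure

theorem hasGradientAt_of_mem {Ω : Set (EuclideanSpace ℝ (Fin d))} (hΩ : IsOpen Ω)
    {F : EuclideanSpace ℝ (Fin d) → ℝ} (hF : F ∈ C1Closure Ω) {x : EuclideanSpace ℝ (Fin d)}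
    (hx : x ∈ Ω) : HasGradientAt F (gradient F x) x :=
  ((hF.1.contDiffAt (hΩ.mem_nhds hx)).differentiableAt (by norm_num)).hasGradientAt

theorem integrableOn_inner_gradient {Ω : Set (EuclideanSpace ℝ (Fin d))} (hΩ : IsOpen Ω)
    (hΩb : Bornology.IsBounded Ω) {F : EuclideanSpace ℝ (Fin d) → ℝ} (hF : F ∈ C1Closure Ω)
    (ξ : EuclideanSpace ℝ (Fin d)) : IntegrableOn (fun y => inner ℝ (gradient F y) ξ) Ω := by
  obtain ⟨-, -, g, hg, hgF⟩ := hF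
  refine (integrableOn_of_continuousOn_closure hΩb
    (f := fun y => inner ℝ (g y) ξ) (hg.inner continuousOn_const)).congr_fun
      (fun y hy => ?_) hΩ.measurableSet
  simp only [hgF hy]

theorem outwardNormal_norm_le (Ω : Set (EuclideanSpace ℝ (Fin d)))
    (x : EuclideanSpace ℝ (Fin d)) : ‖outwardNormal Ω x‖ ≤ 1 := by
  unfold outwardNormal
  split_ifs with h
  · rw [norm_smul, norm_inv, norm_norm]
    exact inv_mul_le_one
  · simp

/-- The normal is chosen pointwise, but by `outwardNormal_eq` a single `ρ` computes it at all nearby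
boundary points. -/
theorem continuousWithinAt_outwardNormal {Ω : Set (EuclideanSpace ℝ (Fin d))} (hΩ : IsOpen Ω)
    {x : EuclideanSpace ℝ (Fin d)} (hx : x ∈ smoothBoundary Ω) :
    ContinuousWithinAt (outwardNormal Ω) (frontier Ω) x := by
  obtain ⟨hxf, ρ, hρ⟩ := hx
  have h1 : ContinuousAt (fun y => ‖gradient ρ y‖⁻¹ • gradient ρ y) x :=
    (hρ.continuousAt_gradient.norm.inv₀ (norm_ne_zero_iff.2 hρ.gradient_ne_zero)).smul
      hρ.continuousAt_gradient
  refine h1.continuousWithinAt.congr_of_eventuallyEq ?_ (outwardNormal_eq hxf hΩ hρ)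
  filter_upwards [self_mem_nhdsWithin, mem_nhdsWithin_of_mem_nhds hρ.eventually] with y hy1 hy2
    using outwardNormal_eq hy1 hΩ hy2

/-- Strict differentiability of `ρ` at `x` bounds `ρ y - ρ z - ⟨∇ρ(x), y - z⟩`, and `ρ` vanishes at
both boundary points. -/
theorem outwardNormal_flat {Ω : Set (EuclideanSpace ℝ (Fin d))} (hΩ : IsOpen Ω)
    {x : EuclideanSpace ℝ (Fin d)} (hx : x ∈ smoothBoundary Ω) {η : ℝ} (hη : 0 < η) :
    ∃ V ∈ 𝓝[frontier Ω] x, ∀ y ∈ V, ∀ z ∈ V,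
      |inner ℝ (outwardNormal Ω x) (y - z)| ≤ η * ‖y - z‖ := by
  obtain ⟨hxf, ρ, hρ⟩ := hx
  have hg0 : 0 < ‖gradient ρ x‖ := norm_pos_iff.2 hρ.gradient_ne_zero
  have hstrict := (hρ.contDiffAt.hasStrictFDerivAt (by norm_num)).isLittleO.def
    (mul_pos hη hg0)
  rw [nhds_prod_eq, Filter.eventually_prod_self_iff'] at hstrict
  obtain ⟨V, hV, hVs⟩ := hstrict
  refine ⟨V ∩ {y | IsDefiningFunctionAt Ω ρ y} ∩ frontier Ω, Filter.inter_mem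
    (mem_nhdsWithin_of_mem_nhds (Filter.inter_mem hV hρ.eventually)) self_mem_nhdsWithin, ?_⟩
  rintro y ⟨⟨hy1, hy2⟩, hy3⟩ z ⟨⟨hz1, hz2⟩, hz3⟩
  have h1 := hVs y hy1 z hz1
  simp only [hy2.apply_eq_zero hy3 hΩ, hz2.apply_eq_zero hz3 hΩ, sub_self, zero_sub, norm_neg,
    Real.norm_eq_abs] at h1
  have h2 : fderiv ℝ ρ x (y - z) = inner ℝ (gradient ρ x) (y - z) := by
    simp [gradient]
  rw [h2] at h1
  rw [outwardNormal_eq hxf hΩ hρ, real_inner_smul_left, abs_mul, abs_inv, abs_norm,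
    inv_mul_le_iff₀ hg0]
  linarith

/-- The divergence theorem for the vector field `F ξ`. -/
def DivergenceAlong (Ω : Set (EuclideanSpace ℝ (Fin d))) (ξ : EuclideanSpace ℝ (Fin d))
    (F : EuclideanSpace ℝ (Fin d) → ℝ) : Prop :=
  ∫ y in Ω, inner ℝ (gradient F y) ξ =
    surfaceIntegral Ω (fun y => F y * inner ℝ ξ (outwardNormal Ω y))

theorem gradient_eq_zero_of_notMem_tsupport {F : EuclideanSpace ℝ (Fin d) → ℝ}
    {x : EuclideanSpace ℝ (Fin d)} (hx : x ∉ tsupport F) : gradient F x = 0 := by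
  have : F =ᶠ[𝓝 x] fun _ => 0 := notMem_tsupport_iff_eventuallyEq.1 hx
  simp [gradient, this.fderiv_eq]

/-- On each line parallel to `v` the fundamental theorem of calculus leaves only the value of `F` at
the point where the line exits `Ω`. Integrating over the base gives the flux, because `⟨v, n⟩ ds` is
the base volume. -/
theorem divergenceAlong_of_transversal {Ω : Set (EuclideanSpace ℝ (Fin d))} (hΩ : IsOpen Ω)
    (hΩb : Bornology.IsBounded Ω)
    {ρ : EuclideanSpace ℝ (Fin d) → ℝ} {p v : EuclideanSpace ℝ (Fin d)} (hp : p ∈ frontier Ω)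
    (h : IsDefiningFunctionAt Ω ρ p) (hv : ‖v‖ = 1) (hvp : 0 < inner ℝ v (gradient ρ p)) :
    ∃ U, IsOpen U ∧ p ∈ U ∧ ∀ F ∈ C1Closure Ω, tsupport F ⊆ U → DivergenceAlong Ω v F := by
  obtain ⟨a₁, a₂, S, γ, hSo, hpS, hpa, hγc, hγa, hΩiff, hfriff, hdef⟩ :=
    h.exists_subgraph hΩ hp hv hvp
  set π := (ℝ ∙ v)ᗮ.orthogonalProjectionOnto with hπ
  have hvv : inner ℝ v v = (1 : ℝ) := by simp [hv]
  have hvy : ∀ y : (ℝ ∙ v)ᗮ, inner ℝ v (y : EuclideanSpace ℝ (Fin d)) = (0 : ℝ) := fun y =>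
    Submodule.mem_orthogonal_singleton_iff_inner_right.1 y.2
  have hdec : ∀ x, (inner ℝ v x : ℝ) • v + (π x : EuclideanSpace ℝ (Fin d)) = x := by
    intro x; rw [hπ, coe_orthogonalProjectionOnto_orthogonal hv]; simp
  have hin : ∀ (t : ℝ) (y : (ℝ ∙ v)ᗮ),
      inner ℝ v (t • v + (y : EuclideanSpace ℝ (Fin d))) = t := by
    intro t y; rw [inner_add_right, inner_smul_right, hvv, hvy]; ring
  have hπe : ∀ (t : ℝ) (y : (ℝ ∙ v)ᗮ), π (t • v + (y : EuclideanSpace ℝ (Fin d))) = y := by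
    intro t y
    apply Subtype.ext
    rw [hπ, coe_orthogonalProjectionOnto_orthogonal hv, hin]
    simp
  set U : Set (EuclideanSpace ℝ (Fin d)) := π ⁻¹' S ∩ (fun x => inner ℝ v x) ⁻¹' Set.Ioo a₁ a₂
    with hU
  have hUo : IsOpen U := by
    refine (hSo.preimage π.continuous).inter (isOpen_Ioo.preimage ?_)
    fun_prop
  refine ⟨U, hUo, ⟨hpS, hpa⟩, fun F hF hFU => ?_⟩
  have hUiff : ∀ (t : ℝ) (y : (ℝ ∙ v)ᗮ), t • v + (y : EuclideanSpace ℝ (Fin d)) ∈ U ↔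
      y ∈ S ∧ t ∈ Set.Ioo a₁ a₂ := by
    intro t y
    rw [hU, Set.mem_inter_iff, Set.mem_preimage, Set.mem_preimage, hπe, hin]
  have hFz : ∀ x, x ∉ U → F x = 0 := fun x hx =>
    image_eq_zero_of_notMem_tsupport fun h => hx (hFU h)
  have hFg : ∀ x, x ∉ U → gradient F x = 0 := fun x hx =>
    gradient_eq_zero_of_notMem_tsupport fun h => hx (hFU h)
  set M := frontier Ω ∩ U with hM
  have hMm : MeasurableSet M := isClosed_frontier.measurableSet.inter hUo.measurableSet
  classical
  set G : (ℝ ∙ v)ᗮ → EuclideanSpace ℝ (Fin d) := fun y => S.piecewise γ 0 y • v + y with hG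
  have hGm : Measurable G := by
    have : Measurable (S.piecewise γ 0) :=
      ContinuousOn.measurable_piecewise hγc continuousOn_const hSo.measurableSet
    exact (this.smul_const v).add measurable_subtype_coe
  have hGS : ∀ y ∈ S, G y = γ y • v + y := by
    intro y hy; simp only [hG, Set.piecewise_eq_of_mem _ _ _ hy]
  have hMγ : ∀ x ∈ M, π x ∈ S ∧ inner ℝ v x = γ (π x) := by
    rintro x ⟨hx1, hx2, hx3⟩
    refine ⟨hx2, (hfriff _ hx2 _ hx3).1 ?_⟩
    rwa [hdec]
  have hMG : ∀ x ∈ M, G (π x) = x := by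
    intro x hx
    rw [hGS _ (hMγ x hx).1, ← (hMγ x hx).2, hdec]
  have hGM : ∀ y ∈ S, G y ∈ M := by
    intro y hy
    rw [hGS y hy]
    exact ⟨(hfriff y hy _ (hγa y hy)).2 rfl, (hUiff _ _).2 ⟨hy, hγa y hy⟩⟩
  have hMdef : ∀ x ∈ M, IsDefiningFunctionAt Ω ρ x ∧ 0 < inner ℝ v (gradient ρ x) := by
    intro x hx
    have := hdef (π x) (hMγ x hx).1
    rwa [← (hMγ x hx).2, hdec] at this
  have hMs : ∀ x ∈ M, x ∈ smoothBoundary Ω := fun x hx => ⟨hx.1, ρ, (hMdef x hx).1⟩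
  have hmap := map_volume_graph hv hMm hGm (S := S) (n := outwardNormal Ω)
    (fun y hy => ⟨hGM y hy, by rw [hGS y hy, ← hπ, hπe]⟩)
    (fun x hx => ⟨(hMγ x hx).1, hMG x hx⟩)
    (fun x hx => by
      rw [outwardNormal_eq hx.1 hΩ (hMdef x hx).1, norm_smul, norm_inv, norm_norm,
        inv_mul_cancel₀ (norm_ne_zero_iff.2 (hMdef x hx).1.gradient_ne_zero)])
    (fun x hx => by
      rw [outwardNormal_eq hx.1 hΩ (hMdef x hx).1, inner_smul_right]
      exact mul_pos (inv_pos.2 (norm_pos_iff.2 (hMdef x hx).1.gradient_ne_zero)) (hMdef x hx).2)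
    (fun x hx => (continuousWithinAt_outwardNormal hΩ (hMs x hx)).mono Set.inter_subset_left)
    (fun x hx η hη => by
      obtain ⟨V, hV, hVf⟩ := outwardNormal_flat hΩ (hMs x hx) hη
      exact ⟨V, nhdsWithin_mono _ Set.inter_subset_left hV, hVf⟩)
  rw [finrank_euclideanSpace_fin] at hmap
  have hncont : ContinuousOn (outwardNormal Ω) M := fun x hx =>
    (continuousWithinAt_outwardNormal hΩ (hMs x hx)).mono Set.inter_subset_left
  have hcpos : ∀ x ∈ M, 0 ≤ (inner ℝ v (outwardNormal Ω x) : ℝ) := fun x hx => by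
    rw [outwardNormal_eq hx.1 hΩ (hMdef x hx).1, inner_smul_right]
    exact mul_nonneg (by positivity) (hMdef x hx).2.le
  have hFc : ContinuousOn F M := hF.2.1.mono
    (Set.inter_subset_left.trans frontier_subset_closure)

  have hsurf : surfaceIntegral Ω (fun y => F y * inner ℝ v (outwardNormal Ω y))
      = ∫ y in S, F (G y) := by
    have h1 : surfaceIntegral Ω (fun y => F y * inner ℝ v (outwardNormal Ω y))
        = ∫ y in M, F y * inner ℝ v (outwardNormal Ω y) ∂μHE[d - 1] := by
      rw [surfaceIntegral]
      refine setIntegral_eq_of_subset_of_forall_sdiff_eq_zero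
        isClosed_frontier.measurableSet Set.inter_subset_left ?_
      rintro x ⟨hx1, hx2⟩
      rw [hFz x fun h => hx2 ⟨hx1, h⟩, zero_mul]
    have hmeas : AEMeasurable (fun x => ENNReal.ofReal (inner ℝ v (outwardNormal Ω x)))
        (μHE[d - 1].restrict M) :=
      ((continuousOn_const.inner hncont).aemeasurable hMm).ennreal_ofReal
    have hsm : AEStronglyMeasurable F ((volume.restrict S).map G) := by
      rw [hmap]
      exact (hFc.aestronglyMeasurable hMm).mono_ac (withDensity_absolutelyContinuous _ _)
    rw [h1, ← integral_map hGm.aemeasurable hsm, hmap,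
      integral_withDensity_eq_integral_toReal_smul₀ hmeas (by simp)]
    refine setIntegral_congr_fun hMm fun x hx => ?_
    simp only [smul_eq_mul]
    rw [ENNReal.toReal_ofReal (hcpos x hx), mul_comm]

  rw [DivergenceAlong, hsurf, ← integral_indicator hΩ.measurableSet,
    integral_eq_integral_lines hv
      ((integrableOn_inner_gradient hΩ hΩb hF v).integrable_indicator hΩ.measurableSet),
    ← integral_indicator hSo.measurableSet]
  refine integral_congr_ae (Filter.Eventually.of_forall fun y => ?_)
  by_cases hy : y ∈ S
  swap
  · simp only [Set.indicator_of_notMem hy]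
    refine integral_eq_zero_of_ae (Filter.Eventually.of_forall fun t => ?_)
    have : t • v + (y : EuclideanSpace ℝ (Fin d)) ∉ U := fun h => hy ((hUiff t y).1 h).1
    simp [Set.indicator, hFg _ this]
  simp only [Set.indicator_of_mem hy, hGS y hy]
  obtain ⟨-, hFcl, g, hg, hgF⟩ := id hF
  have hlc : Continuous fun t : ℝ => t • v + (y : EuclideanSpace ℝ (Fin d)) := by fun_prop
  have hay := hγa y hy
  have hmemΩ : ∀ t ∈ Set.Ioo a₁ (γ y), t • v + (y : EuclideanSpace ℝ (Fin d)) ∈ Ω :=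
    fun t ht => (hΩiff y hy t ⟨ht.1, ht.2.trans hay.2⟩).2 ht.2
  have hmemcl : Set.MapsTo (fun t : ℝ => t • v + (y : EuclideanSpace ℝ (Fin d)))
      (Set.Icc a₁ (γ y)) (closure Ω) := by
    rw [← closure_Ioo hay.1.ne]
    exact Set.MapsTo.closure hmemΩ hlc
  have hind : ∀ t : ℝ, Ω.indicator (fun x => inner ℝ (gradient F x) v)
      (t • v + (y : EuclideanSpace ℝ (Fin d))) =
      (Set.Ioo a₁ (γ y)).indicator
        (fun t => inner ℝ (g (t • v + (y : EuclideanSpace ℝ (Fin d)))) v) t := by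
    intro t
    by_cases ht : t ∈ Set.Ioo a₁ (γ y)
    · rw [Set.indicator_of_mem ht, Set.indicator_of_mem (hmemΩ t ht), hgF (hmemΩ t ht)]
    · rw [Set.indicator_of_notMem ht]
      by_cases htU : t • v + (y : EuclideanSpace ℝ (Fin d)) ∈ U
      · have ht' := ((hUiff t y).1 htU).2
        refine Set.indicator_of_notMem (fun hmem => ht ?_) _
        exact ⟨ht'.1, (hΩiff y hy t ht').1 hmem⟩
      · simp [Set.indicator, hFg _ htU]
  simp_rw [hind]
  rw [integral_indicator measurableSet_Ioo, ← integral_Ioc_eq_integral_Ioo,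
    ← intervalIntegral.integral_of_le hay.1.le,
    intervalIntegral.integral_eq_sub_of_hasDerivAt_of_le hay.1.le
      (f := fun t => F (t • v + (y : EuclideanSpace ℝ (Fin d)))) (hFcl.comp hlc.continuousOn hmemcl)]
  -- The bottom point lies outside `U`, as the height interval is open, so `F` vanishes there.
  · have : a₁ • v + (y : EuclideanSpace ℝ (Fin d)) ∉ U :=
      fun h => lt_irrefl _ ((hUiff a₁ y).1 h).2.1
    rw [hFz _ this, sub_zero]
  · intro t ht
    have h1 := hasGradientAt_of_mem hΩ hF (hmemΩ t ht)
    have h2 : HasDerivAt (fun t : ℝ => t • v + (y : EuclideanSpace ℝ (Fin d))) v t := by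
      simpa using ((hasDerivAt_id t).smul_const v).add_const (y : EuclideanSpace ℝ (Fin d))
    rw [hgF (hmemΩ t ht)]
    simpa [Function.comp_def] using h1.hasFDerivAt.comp_hasDerivAt t h2
  · refine ContinuousOn.intervalIntegrable ?_
    rw [Set.uIcc_of_le hay.1.le]
    exact (hg.comp hlc.continuousOn hmemcl).inner continuousOn_const

end MFSBP

/-! ### Localisation of the divergence theorem. -/

namespace MFSBP

variable {d : ℕ} {Ω : Set (EuclideanSpace ℝ (Fin d))}

theorem contDiff_mem_C1Closure {φ : EuclideanSpace ℝ (Fin d) → ℝ} (hφ : ContDiff ℝ 1 φ) :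
    φ ∈ C1Closure Ω :=
  ⟨hφ.contDiffOn, hφ.continuous.continuousOn, gradient φ,
    ((InnerProductSpace.toDual ℝ _).symm.continuous.comp
      (hφ.continuous_fderiv (by norm_num))).continuousOn, fun _ _ => rfl⟩

theorem gradient_mul_of_mem (hΩ : IsOpen Ω) {f g : EuclideanSpace ℝ (Fin d) → ℝ}
    (hf : f ∈ C1Closure Ω) (hg : g ∈ C1Closure Ω) {x : EuclideanSpace ℝ (Fin d)} (hx : x ∈ Ω) :
    gradient (fun y => f y * g y) x = f x • gradient g x + g x • gradient f x := by
  have h1 := (hasGradientAt_of_mem hΩ hf hx).hasFDerivAt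
  have h2 := (hasGradientAt_of_mem hΩ hg hx).hasFDerivAt
  have h3 := (h1.mul h2).hasGradientAt.gradient
  refine h3.trans ?_
  simp [gradient]

theorem gradient_add_of_mem (hΩ : IsOpen Ω) {f g : EuclideanSpace ℝ (Fin d) → ℝ}
    (hf : f ∈ C1Closure Ω) (hg : g ∈ C1Closure Ω) {x : EuclideanSpace ℝ (Fin d)} (hx : x ∈ Ω) :
    gradient (fun y => f y + g y) x = gradient f x + gradient g x := by
  have h1 := (hasGradientAt_of_mem hΩ hf hx).hasFDerivAt
  have h2 := (hasGradientAt_of_mem hΩ hg hx).hasFDerivAt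
  have h3 := (h1.add h2).hasGradientAt.gradient
  refine h3.trans ?_
  simp [gradient]

theorem mul_mem_C1Closure (hΩ : IsOpen Ω) {f g : EuclideanSpace ℝ (Fin d) → ℝ}
    (hf : f ∈ C1Closure Ω) (hg : g ∈ C1Closure Ω) : (fun y => f y * g y) ∈ C1Closure Ω := by
  obtain ⟨hf1, hf2, f', hf3, hf4⟩ := id hf
  obtain ⟨hg1, hg2, g', hg3, hg4⟩ := id hg
  refine ⟨hf1.mul hg1, hf2.mul hg2, fun x => f x • g' x + g x • f' x,
    (hf2.smul hg3).add (hg2.smul hf3), fun x hx => ?_⟩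
  simp only [gradient_mul_of_mem hΩ hf hg hx, hf4 hx, hg4 hx]

theorem add_mem_C1Closure (hΩ : IsOpen Ω) {f g : EuclideanSpace ℝ (Fin d) → ℝ}
    (hf : f ∈ C1Closure Ω) (hg : g ∈ C1Closure Ω) : (fun y => f y + g y) ∈ C1Closure Ω := by
  obtain ⟨hf1, hf2, f', hf3, hf4⟩ := id hf
  obtain ⟨hg1, hg2, g', hg3, hg4⟩ := id hg
  refine ⟨hf1.add hg1, hf2.add hg2, fun x => f' x + g' x, hf3.add hg3, fun x hx => ?_⟩
  simp only [gradient_add_of_mem hΩ hf hg hx, hf4 hx, hg4 hx]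

theorem isOpen_setOf_isDefiningFunctionAt :
    IsOpen {x | ∃ ρ, IsDefiningFunctionAt Ω ρ x} := by
  refine isOpen_iff_mem_nhds.2 ?_
  rintro x ⟨ρ, hρ⟩
  filter_upwards [hρ.eventually] with y hy using ⟨ρ, hy⟩

theorem smoothBoundary_eq_inter :
    smoothBoundary Ω = frontier Ω ∩ {x | ∃ ρ, IsDefiningFunctionAt Ω ρ x} := rfl

theorem HasPiecewiseSmoothBoundary.ae_mem_smoothBoundary (hΩs : HasPiecewiseSmoothBoundary Ω) :
    ∀ᵐ x ∂(μHE[d - 1].restrict (frontier Ω)), x ∈ smoothBoundary Ω := by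
  rw [ae_restrict_iff' isClosed_frontier.measurableSet, ae_iff]
  refine measure_mono_null ?_ hΩs.measure_singular
  intro x hx
  simpa using hx

theorem HasPiecewiseSmoothBoundary.isFiniteMeasure (hΩs : HasPiecewiseSmoothBoundary Ω) :
    IsFiniteMeasure ((μHE[d - 1] : Measure (EuclideanSpace ℝ (Fin d))).restrict (frontier Ω)) :=
  ⟨by rw [Measure.restrict_apply_univ]; exact lt_top_iff_ne_top.2 hΩs.measure_ne_top⟩

theorem HasPiecewiseSmoothBoundary.integrable (hΩ : IsOpen Ω) (hΩb : Bornology.IsBounded Ω)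
    (hΩs : HasPiecewiseSmoothBoundary Ω) {F : EuclideanSpace ℝ (Fin d) → ℝ}
    (hF : ContinuousOn F (closure Ω)) (ξ : EuclideanSpace ℝ (Fin d)) :
    Integrable (fun y => F y * inner ℝ ξ (outwardNormal Ω y))
      (μHE[d - 1].restrict (frontier Ω)) := by
  have := hΩs.isFiniteMeasure
  have hsm : MeasurableSet (smoothBoundary Ω) :=
    isClosed_frontier.measurableSet.inter isOpen_setOf_isDefiningFunctionAt.measurableSet
  have hres : (μHE[d - 1] : Measure (EuclideanSpace ℝ (Fin d))).restrict (frontier Ω)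
      = μHE[d - 1].restrict (smoothBoundary Ω) := by
    refine Measure.restrict_congr_set ?_
    have h1 : smoothBoundary Ω ⊆ frontier Ω := fun x hx => hx.1
    exact (h1.eventuallyLE.antisymm (ae_le_set.2 hΩs.measure_singular)).symm
  have hmeas : AEStronglyMeasurable (fun y => F y * inner ℝ ξ (outwardNormal Ω y))
      (μHE[d - 1].restrict (frontier Ω)) := by
    rw [hres]
    refine ContinuousOn.aestronglyMeasurable ?_ hsm
    refine (hF.mono fun x hx => frontier_subset_closure hx.1).mul
      (continuousOn_const.inner fun x hx => ?_)
    exact (continuousWithinAt_outwardNormal hΩ hx).mono fun y hy => hy.1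
  obtain ⟨C, hC⟩ := hΩb.isCompact_closure.exists_bound_of_continuousOn hF
  refine Integrable.of_bound hmeas (C * ‖ξ‖) ?_
  rw [ae_restrict_iff' isClosed_frontier.measurableSet]
  refine Filter.Eventually.of_forall fun x hx => ?_
  have hCx := hC x (frontier_subset_closure hx)
  rw [norm_mul]
  refine mul_le_mul hCx ?_ (norm_nonneg _) ((norm_nonneg _).trans hCx)
  refine (norm_inner_le_norm _ _).trans ?_
  exact mul_le_of_le_one_right (norm_nonneg _) (outwardNormal_norm_le Ω x)

/-- Needed because the partition of unity reproduces `F` only on the closure of `Ω`. -/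
theorem DivergenceAlong.congr (hΩ : IsOpen Ω) {ξ : EuclideanSpace ℝ (Fin d)}
    {F F' : EuclideanSpace ℝ (Fin d) → ℝ} (hF : DivergenceAlong Ω ξ F)
    (hFF' : Set.EqOn F F' (closure Ω)) : DivergenceAlong Ω ξ F' := by
  rw [DivergenceAlong, surfaceIntegral] at hF ⊢
  have h1 : ∫ y in Ω, inner ℝ (gradient F' y) ξ = ∫ y in Ω, inner ℝ (gradient F y) ξ := by
    refine setIntegral_congr_fun hΩ.measurableSet fun x hx => ?_
    have : F' =ᶠ[𝓝 x] F := by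
      filter_upwards [hΩ.mem_nhds hx] with y hy using (hFF' (subset_closure hy)).symm
    simp only [gradient, this.fderiv_eq]
  rw [h1, hF]
  refine setIntegral_congr_fun isClosed_frontier.measurableSet fun x hx => ?_
  simp only [hFF' (frontier_subset_closure hx)]

theorem DivergenceAlong.add (hΩ : IsOpen Ω) (hΩb : Bornology.IsBounded Ω)
    (hΩs : HasPiecewiseSmoothBoundary Ω) {ξ : EuclideanSpace ℝ (Fin d)}
    {f g : EuclideanSpace ℝ (Fin d) → ℝ} (hf : f ∈ C1Closure Ω) (hg : g ∈ C1Closure Ω)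
    (hdf : DivergenceAlong Ω ξ f) (hdg : DivergenceAlong Ω ξ g) :
    DivergenceAlong Ω ξ (fun y => f y + g y) := by
  rw [DivergenceAlong, surfaceIntegral] at hdf hdg ⊢
  have h1 : ∫ y in Ω, inner ℝ (gradient (fun y => f y + g y) y) ξ
      = ∫ y in Ω, (inner ℝ (gradient f y) ξ + inner ℝ (gradient g y) ξ) := by
    refine setIntegral_congr_fun hΩ.measurableSet fun x hx => ?_
    simp only [gradient_add_of_mem hΩ hf hg hx, inner_add_left]
  rw [h1, integral_add (integrableOn_inner_gradient hΩ hΩb hf ξ)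
    (integrableOn_inner_gradient hΩ hΩb hg ξ), hdf, hdg,
    ← integral_add (hΩs.integrable hΩ hΩb hf.2.1 ξ) (hΩs.integrable hΩ hΩb hg.2.1 ξ)]
  simp only [add_mul]

theorem divergenceAlong_zero (ξ : EuclideanSpace ℝ (Fin d)) :
    DivergenceAlong Ω ξ (fun _ => 0) := by
  simp [DivergenceAlong, surfaceIntegral, gradient]

theorem divergenceAlong_sum (hΩ : IsOpen Ω) (hΩb : Bornology.IsBounded Ω)
    (hΩs : HasPiecewiseSmoothBoundary Ω) {ξ : EuclideanSpace ℝ (Fin d)} {ι : Type*}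
    (s : Finset ι) {f : ι → EuclideanSpace ℝ (Fin d) → ℝ} (hf : ∀ i ∈ s, f i ∈ C1Closure Ω)
    (hdf : ∀ i ∈ s, DivergenceAlong Ω ξ (f i)) :
    (fun y => ∑ i ∈ s, f i y) ∈ C1Closure Ω ∧
      DivergenceAlong Ω ξ (fun y => ∑ i ∈ s, f i y) := by
  classical
  induction s using Finset.induction_on with
  | empty =>
    simp only [Finset.sum_empty]
    exact ⟨contDiff_mem_C1Closure contDiff_const, divergenceAlong_zero ξ⟩
  | insert a s ha ih =>
    simp only [Finset.sum_insert ha]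
    obtain ⟨h1, h2⟩ := ih (fun i hi => hf i (Finset.mem_insert_of_mem hi))
      (fun i hi => hdf i (Finset.mem_insert_of_mem hi))
    have h3 := hf a (Finset.mem_insert_self a s)
    exact ⟨add_mem_C1Closure hΩ h3 h1,
      (hdf a (Finset.mem_insert_self a s)).add hΩ hΩb hΩs h3 h1 h2⟩

theorem DivergenceAlong.linear_comb (hΩ : IsOpen Ω) (hΩb : Bornology.IsBounded Ω)
    (hΩs : HasPiecewiseSmoothBoundary Ω) {F : EuclideanSpace ℝ (Fin d) → ℝ}
    (hF : F ∈ C1Closure Ω) {v w : EuclideanSpace ℝ (Fin d)} (hv : DivergenceAlong Ω v F)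
    (hw : DivergenceAlong Ω w F) (a b : ℝ) : DivergenceAlong Ω (a • v + b • w) F := by
  rw [DivergenceAlong, surfaceIntegral] at hv hw ⊢
  simp only [inner_add_right, inner_add_left, real_inner_smul_left, real_inner_smul_right, mul_add,
    mul_left_comm _ a, mul_left_comm _ b]
  rw [integral_add ((integrableOn_inner_gradient hΩ hΩb hF v).const_mul a)
    ((integrableOn_inner_gradient hΩ hΩb hF w).const_mul b),
    integral_add ((hΩs.integrable hΩ hΩb hF.2.1 v).const_mul a)
      ((hΩs.integrable hΩ hΩb hF.2.1 w).const_mul b)]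
  simp only [integral_const_mul, hv, hw]

/-- There is no boundary term: extended by zero, `F` is differentiable everywhere, and integration
by parts against the constant 1 shows that the integral of its derivative is 0. -/
theorem divergenceAlong_of_tsupport_subset (hΩ : IsOpen Ω) (hΩb : Bornology.IsBounded Ω)
    {F : EuclideanSpace ℝ (Fin d) → ℝ} (hF : F ∈ C1Closure Ω) (hFs : tsupport F ⊆ Ω)
    (ξ : EuclideanSpace ℝ (Fin d)) : DivergenceAlong Ω ξ F := by
  have hdiff : Differentiable ℝ F := by
    intro x
    by_cases hx : x ∈ Ω
    · exact (hasGradientAt_of_mem hΩ hF hx).hasFDerivAt.differentiableAt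
    · have : F =ᶠ[𝓝 x] fun _ => 0 := notMem_tsupport_iff_eventuallyEq.1 fun h => hx (hFs h)
      exact (differentiableAt_const (0 : ℝ)).congr_of_eventuallyEq this
  have hFz : ∀ x, x ∉ Ω → F x = 0 := fun x hx =>
    image_eq_zero_of_notMem_tsupport fun h => hx (hFs h)
  have hFg : ∀ x, x ∉ Ω → gradient F x = 0 := fun x hx =>
    gradient_eq_zero_of_notMem_tsupport fun h => hx (hFs h)
  have hFi : Integrable F := by
    rw [← integrableOn_iff_integrable_of_support_subset (s := Ω)
      fun x hx => by_contra fun h => hx (hFz x h)]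
    exact integrableOn_of_continuousOn_closure hΩb hF.2.1
  have hgz : ∀ x, x ∉ Ω → inner ℝ (gradient F x) ξ = (0 : ℝ) := fun x hx => by simp [hFg x hx]
  have hfd : ∀ x, fderiv ℝ F x ξ = inner ℝ (gradient F x) ξ := fun x => by simp [gradient]
  have hgi : Integrable (fun x => inner ℝ (gradient F x) ξ) := by
    rw [← integrableOn_iff_integrable_of_support_subset (s := Ω)
      fun x hx => by_contra fun h => hx (hgz x h)]
    exact integrableOn_inner_gradient hΩ hΩb hF ξ
  have h0 := integral_mul_fderiv_eq_neg_fderiv_mul_of_integrable (μ := volume)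
    (f := fun _ : EuclideanSpace ℝ (Fin d) => (1 : ℝ)) (g := F) (v := ξ) (by simp)
    (by simpa only [one_mul, hfd] using hgi) (by simpa using hFi)
    (fun x _ => differentiableAt_const _) (fun x _ => hdiff x)
  simp only [one_mul, hfd, fderiv_fun_const, Pi.zero_apply, zero_apply, zero_mul,
    integral_zero, neg_zero] at h0
  rw [DivergenceAlong, surfaceIntegral, setIntegral_eq_integral_of_forall_compl_eq_zero hgz, h0,
    eq_comm]
  refine setIntegral_eq_zero_of_forall_eq_zero fun x hx => ?_
  rw [hΩ.frontier_eq] at hx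
  rw [hFz x hx.2, zero_mul]

/-- The divergence theorem holds locally, near points of `Ω` and near smooth boundary points. -/
theorem exists_nhds_divergenceAlong (hΩ : IsOpen Ω) (hΩb : Bornology.IsBounded Ω)
    (hΩs : HasPiecewiseSmoothBoundary Ω) (ξ : EuclideanSpace ℝ (Fin d))
    {p : EuclideanSpace ℝ (Fin d)} (hp : p ∈ closure Ω) (hps : p ∉ frontier Ω \ smoothBoundary Ω) :
    ∃ U, IsOpen U ∧ p ∈ U ∧ ∀ F ∈ C1Closure Ω, tsupport F ⊆ U → DivergenceAlong Ω ξ F := by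
  by_cases hpΩ : p ∈ Ω
  · exact ⟨Ω, hΩ, hpΩ, fun F hF hFs => divergenceAlong_of_tsupport_subset hΩ hΩb hF hFs ξ⟩
  have hpf : p ∈ frontier Ω := by rw [hΩ.frontier_eq]; exact ⟨hp, hpΩ⟩
  obtain ⟨-, ρ, hρ⟩ : p ∈ smoothBoundary Ω := by_contra fun h => hps ⟨hpf, h⟩
  set G := gradient ρ p with hG
  have hG0 : 0 < ‖G‖ := norm_pos_iff.2 hρ.gradient_ne_zero
  set n := ‖G‖⁻¹ • G with hn
  have hn1 : ‖n‖ = 1 := by rw [hn, norm_smul, norm_inv, norm_norm, inv_mul_cancel₀ hG0.ne']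
  have hGn : G = ‖G‖ • n := by rw [hn, smul_smul, mul_inv_cancel₀ hG0.ne', one_smul]
  -- `ξ` may be tangential or point inwards. The coefficient `‖ξ‖ + 1` makes `⟨w, n⟩ ≥ 1`, so both
  -- `w` and `n` are transversal, and `ξ` is a combination of them.
  set w := ξ + (‖ξ‖ + 1) • n with hw
  have hwn : 0 < inner ℝ w n := by
    have h1 := neg_le_of_abs_le (abs_real_inner_le_norm ξ n)
    rw [hw, inner_add_left, real_inner_smul_left, real_inner_self_eq_norm_sq]
    rw [hn1] at h1 ⊢
    linarith
  have hw0 : 0 < ‖w‖ := norm_pos_iff.2 (by rintro h; simp [h] at hwn)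
  set v := ‖w‖⁻¹ • w with hv
  have hv1 : ‖v‖ = 1 := by rw [hv, norm_smul, norm_inv, norm_norm, inv_mul_cancel₀ hw0.ne']
  obtain ⟨U₁, hU₁, hp₁, h₁⟩ := divergenceAlong_of_transversal hΩ hΩb hpf hρ hn1
    (by rw [← hG, hGn, inner_smul_right, real_inner_self_eq_norm_sq, hn1]; positivity)
  obtain ⟨U₂, hU₂, hp₂, h₂⟩ := divergenceAlong_of_transversal hΩ hΩb hpf hρ hv1
    (by rw [← hG, hGn, inner_smul_right, hv, real_inner_smul_left]; positivity)
  refine ⟨U₁ ∩ U₂, hU₁.inter hU₂, ⟨hp₁, hp₂⟩, fun F hF hFs => ?_⟩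
  have hξ : ξ = ‖w‖ • v + (-(‖ξ‖ + 1)) • n := by
    rw [hv, smul_smul, mul_inv_cancel₀ hw0.ne', one_smul, hw]
    module
  rw [hξ]
  exact (h₂ F hF (hFs.trans Set.inter_subset_right)).linear_comb hΩ hΩb hΩs hF
    (h₁ F hF (hFs.trans Set.inter_subset_left)) _ _

open scoped Manifold ContDiff in
theorem divergenceAlong_of_eq_zero_near_singular (hΩ : IsOpen Ω) (hΩb : Bornology.IsBounded Ω)
    (hΩs : HasPiecewiseSmoothBoundary Ω) (ξ : EuclideanSpace ℝ (Fin d))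
    {F : EuclideanSpace ℝ (Fin d) → ℝ} (hF : F ∈ C1Closure Ω)
    {O : Set (EuclideanSpace ℝ (Fin d))} (hO : IsOpen O)
    (hsO : frontier Ω \ smoothBoundary Ω ⊆ O) (hFO : ∀ x ∈ O, F x = 0) :
    DivergenceAlong Ω ξ F := by
  have hK : IsCompact (closure Ω \ O) := hΩb.isCompact_closure.diff hO
  have hloc : ∀ p : EuclideanSpace ℝ (Fin d), ∃ U, IsOpen U ∧ (p ∈ closure Ω \ O →
      p ∈ U ∧ ∀ F ∈ C1Closure Ω, tsupport F ⊆ U → DivergenceAlong Ω ξ F) := by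
    intro p
    by_cases hp : p ∈ closure Ω \ O
    · obtain ⟨U, h1, h2, h3⟩ := exists_nhds_divergenceAlong hΩ hΩb hΩs ξ hp.1
        fun h => hp.2 (hsO h)
      exact ⟨U, h1, fun _ => ⟨h2, h3⟩⟩
    · exact ⟨∅, isOpen_empty, fun h => absurd h hp⟩
  choose U hUo hU using hloc
  obtain ⟨T, hTK, hT⟩ := hK.elim_nhds_subcover U fun p hp => (hUo p).mem_nhds (hU p hp).1
  obtain ⟨ψ, hψ⟩ := SmoothPartitionOfUnity.exists_isSubordinate
    𝓘(ℝ, EuclideanSpace ℝ (Fin d)) hK.isClosed (fun i : T => U i) (fun i => hUo i)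
    (by simpa [Set.iUnion_subtype] using hT)
  have hψF : ∀ i : T, (fun y => ψ i y * F y) ∈ C1Closure Ω := fun i =>
    mul_mem_C1Closure hΩ (contDiff_mem_C1Closure ((ψ i).contMDiff.contDiff.of_le (by simp))) hF
  have hdiv : ∀ i : T, DivergenceAlong Ω ξ (fun y => ψ i y * F y) := fun i =>
    (hU i (hTK i i.2)).2 _ (hψF i) ((tsupport_mul_subset_left (f := ψ i) (g := F)).trans (hψ i))
  -- The localised pieces sum to `F` on the closure: off `O` the partition sums to 1, and on `O`
  -- both sides vanish.
  refine (divergenceAlong_sum hΩ hΩb hΩs Finset.univ (fun i _ => hψF i)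
    (fun i _ => hdiv i)).2.congr hΩ fun x hx => ?_
  simp only [← Finset.sum_mul]
  by_cases hxO : x ∈ O
  · simp [hFO x hxO]
  · have := ψ.sum_eq_one ⟨hx, hxO⟩
    rw [finsum_eq_sum_of_fintype] at this
    rw [this, one_mul]

end MFSBP

/-! ### Covers of null sets and cutoff functions. -/

namespace MFSBP

/-- A compact set of vanishing `m`-dimensional Hausdorff measure is covered by finitely many small
balls such that the sum of the `m`-th powers of the radii is small. -/
theorem exists_finite_ball_cover {X : Type*} [MetricSpace X] [MeasurableSpace X] [BorelSpace X]
    [Nonempty X] {m : ℕ} {K : Set X} (hK : IsCompact K) (h0 : μHE[m] K = 0) {ε : ℝ} (hε : 0 < ε) :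
    ∃ (T : Finset ℕ) (c : ℕ → X) (r : ℕ → ℝ), (∀ i ∈ T, c i ∈ K ∧ 0 < r i ∧ r i < ε) ∧
      K ⊆ (⋃ i ∈ T, Metric.ball (c i) (r i)) ∧ ∑ i ∈ T, r i ^ m < ε := by
  classical
  have h0' : μH[(m : ℝ)] K = 0 := by
    rw [Measure.euclideanHausdorffMeasure_def, Measure.smul_apply, ENNReal.smul_def, smul_eq_mul,
      mul_eq_zero] at h0
    refine h0.resolve_left ?_
    simpa using Measure.addHaarScalarFactor_volume_hausdorffMeasure_ne_zero m
  rcases K.eq_empty_or_nonempty with rfl | hKn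
  · exact ⟨∅, fun _ => Classical.arbitrary X, fun _ => 0, by simp, by simp, by simpa using hε⟩
  -- For `m = 0` a nonempty set has measure at least 1, so this case is void.
  rcases Nat.eq_zero_or_pos m with rfl | hm
  · have := Measure.one_le_hausdorffMeasure_zero_of_nonempty hKn
    rw [Nat.cast_zero] at h0'
    simp [h0'] at this
  obtain ⟨x₀, hx₀⟩ := hKn
  -- The bound `2η ≤ ε` serves the sum of the powers, and `2η ≤ ε ^ m` the single radii.
  set η : ℝ := min (ε / 2) (ε ^ m / 2) with hη
  have hη0 : 0 < η := by positivity
  rw [Measure.hausdorffMeasure_apply] at h0'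
  simp only [ENNReal.iSup_eq_zero] at h0'
  -- Scale 1 suffices, merely to have finite diameters: smallness of each radius will follow from
  -- smallness of the sum.
  have h2 : (⨅ (t : ℕ → Set X) (_ : K ⊆ ⋃ n, t n) (_ : ∀ n, Metric.ediam (t n) ≤ 1),
      ∑' n, ⨆ _ : (t n).Nonempty, Metric.ediam (t n) ^ (m : ℝ)) < ENNReal.ofReal η := by
    rw [h0' 1 one_pos]; simpa using hη0
  simp only [iInf_lt_iff] at h2
  obtain ⟨t, htK, htd, hts⟩ := h2
  set e : ℕ → ℝ := fun n => (Metric.ediam (t n)).toReal with he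
  have htop : ∀ n, Metric.ediam (t n) ≠ ⊤ := fun n => ne_top_of_le_ne_top ENNReal.one_ne_top (htd n)
  set a : ℕ → ℝ := fun n => if (t n).Nonempty then e n ^ m else 0 with ha
  have ha0 : ∀ n, 0 ≤ a n := fun n => by simp only [ha]; split_ifs <;> positivity
  have haE : ∀ n, ENNReal.ofReal (a n) = ⨆ _ : (t n).Nonempty, Metric.ediam (t n) ^ (m : ℝ) := by
    intro n
    by_cases hn : (t n).Nonempty
    · simp only [ha, hn, if_true, iSup_pos, he]
      rw [ENNReal.rpow_natCast, ENNReal.ofReal_pow ENNReal.toReal_nonneg,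
        ENNReal.ofReal_toReal (htop n)]
    · simp [ha, hn]
  have hasum : ∀ T : Finset ℕ, ∑ n ∈ T, a n < η := by
    intro T
    rw [← ENNReal.ofReal_lt_ofReal_iff hη0, ENNReal.ofReal_sum_of_nonneg fun n _ => ha0 n]
    refine lt_of_le_of_lt ?_ hts
    simp only [haE]
    exact ENNReal.sum_le_tsum T
  -- The summable surplus `u` makes every radius positive and strictly larger than the diameter of
  -- its set, so an open ball centred in the set contains it.
  obtain ⟨u, hu0, s, hus, hsη⟩ := posSumOfEncodable hη0 ℕ
  have husum : ∀ T : Finset ℕ, ∑ n ∈ T, u n ≤ η := fun T =>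
    (sum_le_hasSum T (fun n _ => (hu0 n).le) hus).trans hsη
  set r : ℕ → ℝ := fun n => (a n + u n) ^ ((m : ℝ)⁻¹) with hr
  have hau : ∀ n, 0 < a n + u n := fun n => add_pos_of_nonneg_of_pos (ha0 n) (hu0 n)
  have hr0 : ∀ n, 0 < r n := fun n => Real.rpow_pos_of_pos (hau n) _
  have hrm : ∀ n, r n ^ m = a n + u n := fun n => Real.rpow_inv_natCast_pow (hau n).le hm.ne'
  have hrsum : ∀ T : Finset ℕ, ∑ n ∈ T, r n ^ m < 2 * η := by
    intro T
    simp only [hrm, Finset.sum_add_distrib]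
    linarith [hasum T, husum T]
  have hη1 : 2 * η ≤ ε := by linarith [min_le_left (ε / 2) (ε ^ m / 2)]
  have hη2 : 2 * η ≤ ε ^ m := by linarith [min_le_right (ε / 2) (ε ^ m / 2)]
  have hc : ∀ n, ∃ c ∈ K, (t n ∩ K).Nonempty → c ∈ t n := by
    intro n
    by_cases hn : (t n ∩ K).Nonempty
    · obtain ⟨c, hc1, hc2⟩ := hn
      exact ⟨c, hc2, fun _ => hc1⟩
    · exact ⟨x₀, hx₀, fun h => absurd h hn⟩
  choose c hcK hct using hc
  obtain ⟨T, hT⟩ := hK.elim_finite_subcover (fun n => Metric.ball (c n) (r n))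
    (fun n => Metric.isOpen_ball) (by
      intro x hx
      obtain ⟨n, hn⟩ := Set.mem_iUnion.1 (htK hx)
      refine Set.mem_iUnion.2 ⟨n, ?_⟩
      have hcn := hct n ⟨x, hn, hx⟩
      have h1 : dist x (c n) ≤ e n := by
        rw [dist_edist]
        exact ENNReal.toReal_mono (htop n) (Metric.edist_le_ediam_of_mem hn hcn)
      refine Metric.mem_ball.2 (h1.trans_lt ?_)
      refine lt_of_pow_lt_pow_left₀ m (hr0 n).le ?_
      have han : a n = e n ^ m := if_pos ⟨x, hn⟩
      rw [hrm, han]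
      linarith [hu0 n])
  refine ⟨T, c, r, fun i hi => ⟨hcK i, hr0 i, ?_⟩, hT, (hrsum T).trans_le hη1⟩
  refine lt_of_pow_lt_pow_left₀ m hε.le (lt_of_lt_of_le ?_ hη2)
  simpa using hrsum {i}

section Cutoff

variable {d : ℕ}

/-- A cutoff function that vanishes on a ball and is `1` outside the ball of twice the radius, with
an estimate of the derivative. -/
theorem exists_ball_cutoff (hd : 0 < d) : ∃ C : ℝ, 0 ≤ C ∧
    ∀ (c : EuclideanSpace ℝ (Fin d)) (r : ℝ), 0 < r → ∃ φ : EuclideanSpace ℝ (Fin d) → ℝ,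
      ContDiff ℝ 1 φ ∧ (∀ x, φ x ∈ Set.Icc (0 : ℝ) 1) ∧ (∀ x ∈ Metric.ball c r, φ x = 0) ∧
      (∀ x, 2 * r ≤ dist x c → φ x = 1) ∧ Integrable (fun x => ‖fderiv ℝ φ x‖) ∧
      ∫ x, ‖fderiv ℝ φ x‖ ≤ C * r ^ (d - 1) := by
  let χ : ContDiffBump (0 : EuclideanSpace ℝ (Fin d)) := ⟨1, 2, one_pos, one_lt_two⟩
  have hχ : ContDiff ℝ 1 χ := χ.contDiff
  refine ⟨∫ x, ‖fderiv ℝ χ x‖, integral_nonneg fun x => norm_nonneg _, fun c r hr => ?_⟩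
  set φ : EuclideanSpace ℝ (Fin d) → ℝ := fun x => 1 - χ (r⁻¹ • (x - c)) with hφ
  have hφc : ContDiff ℝ 1 φ :=
    contDiff_const.sub (hχ.comp (by fun_prop))
  have hfd : ∀ x, ‖fderiv ℝ φ x‖ = r⁻¹ * ‖fderiv ℝ χ (r⁻¹ • (x - c))‖ := by
    intro x
    have h1 : HasFDerivAt (fun x : EuclideanSpace ℝ (Fin d) => r⁻¹ • (x - c))
        (r⁻¹ • ContinuousLinearMap.id ℝ _) x :=
      ((hasFDerivAt_id x).sub_const c).const_smul r⁻¹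
    have h2 := (hχ.differentiable (by norm_num) (r⁻¹ • (x - c))).hasFDerivAt
    have h3 := ((h2.comp x h1).const_sub 1).fderiv
    have h4 : fderiv ℝ φ x = -(r⁻¹ • fderiv ℝ χ (r⁻¹ • (x - c))) := by
      refine h3.trans ?_
      simp
    rw [h4, norm_neg, norm_smul, norm_inv, Real.norm_eq_abs, abs_of_pos hr]
  have hint : Integrable (fun x => ‖fderiv ℝ χ x‖) :=
    (((hχ.continuous_fderiv (by norm_num)).integrable_of_hasCompactSupport
      (χ.hasCompactSupport.fderiv ℝ))).norm
  have hnorm : ∀ x, ‖r⁻¹ • (x - c)‖ = r⁻¹ * dist x c := by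
    intro x
    rw [norm_smul, norm_inv, Real.norm_eq_abs, abs_of_pos hr, dist_eq_norm]
  refine ⟨φ, hφc, fun x => ⟨?_, ?_⟩, fun x hx => ?_, fun x hx => ?_, ?_, ?_⟩
  · simp only [hφ]; linarith [χ.le_one (x := r⁻¹ • (x - c))]
  · simp only [hφ]; linarith [χ.nonneg (x := r⁻¹ • (x - c))]
  · have : χ (r⁻¹ • (x - c)) = 1 := by
      refine χ.one_of_mem_closedBall ?_
      rw [mem_closedBall_zero_iff, hnorm, inv_mul_le_iff₀ hr, mul_one]
      exact (Metric.mem_ball.1 hx).le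
    simp [hφ, this]
  · have : χ (r⁻¹ • (x - c)) = 0 := by
      refine χ.zero_of_le_dist ?_
      rw [dist_zero_right, hnorm, le_inv_mul_iff₀ hr, mul_comm]
      exact hx
    simp [hφ, this]
  · simp only [hfd]
    exact ((hint.comp_smul (inv_ne_zero hr.ne')).comp_sub_right c).const_mul r⁻¹
  · simp only [hfd]
    -- Scaling: the derivative contributes `r⁻¹` and the volume `r ^ d`.
    rw [integral_const_mul, integral_sub_right_eq_self (fun x => ‖fderiv ℝ χ (r⁻¹ • x)‖) c,
      Measure.integral_comp_smul volume (fun x => ‖fderiv ℝ χ x‖) r⁻¹, finrank_euclideanSpace_fin,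
      inv_pow, inv_inv, abs_of_pos (by positivity), smul_eq_mul]
    obtain ⟨k, rfl⟩ : ∃ k, d = k + 1 := ⟨d - 1, by omega⟩
    rw [Nat.add_sub_cancel, pow_succ]
    apply le_of_eq
    field_simp

/-- Multiply the single-ball cutoffs. As all factors lie in `[0, 1]`, the norm of the derivative of
the product is at most the sum of the norms of the derivatives. -/
theorem exists_balls_cutoff (hd : 0 < d) : ∃ C : ℝ, 0 ≤ C ∧
    ∀ (T : Finset ℕ) (c : ℕ → EuclideanSpace ℝ (Fin d)) (r : ℕ → ℝ), (∀ i ∈ T, 0 < r i) →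
      ∃ φ : EuclideanSpace ℝ (Fin d) → ℝ,
      ContDiff ℝ 1 φ ∧ (∀ x, φ x ∈ Set.Icc (0 : ℝ) 1) ∧
      (∀ i ∈ T, ∀ x ∈ Metric.ball (c i) (r i), φ x = 0) ∧
      (∀ x, (∀ i ∈ T, 2 * r i ≤ dist x (c i)) → φ x = 1) ∧
      Integrable (fun x => ‖fderiv ℝ φ x‖) ∧
      ∫ x, ‖fderiv ℝ φ x‖ ≤ C * ∑ i ∈ T, r i ^ (d - 1) := by
  classical
  obtain ⟨C, hC, h⟩ := exists_ball_cutoff hd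
  refine ⟨C, hC, fun T c r => ?_⟩
  induction T using Finset.induction_on with
  | empty =>
    intro _
    exact ⟨fun _ => 1, contDiff_const, by simp, by simp, by simp, by simp, by simp⟩
  | insert a T ha ih =>
    intro hr
    obtain ⟨φ, h1, h2, h3, h4, h5, h6⟩ := ih fun i hi => hr i (Finset.mem_insert_of_mem hi)
    obtain ⟨ψ, g1, g2, g3, g4, g5, g6⟩ := h (c a) (r a) (hr a (Finset.mem_insert_self a T))
    have hbound : ∀ x, ‖fderiv ℝ (fun x => ψ x * φ x) x‖ ≤ ‖fderiv ℝ ψ x‖ + ‖fderiv ℝ φ x‖ := by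
      intro x
      rw [fderiv_fun_mul (g1.differentiable (by norm_num) x) (h1.differentiable (by norm_num) x),
        add_comm]
      refine (norm_add_le _ _).trans (add_le_add ?_ ?_)
      · rw [norm_smul, Real.norm_eq_abs, abs_of_nonneg (h2 x).1]
        exact mul_le_of_le_one_left (norm_nonneg _) (h2 x).2
      · rw [norm_smul, Real.norm_eq_abs, abs_of_nonneg (g2 x).1]
        exact mul_le_of_le_one_left (norm_nonneg _) (g2 x).2
    have hcd : ContDiff ℝ 1 (fun x => ψ x * φ x) := g1.mul h1
    have hi : Integrable (fun x => ‖fderiv ℝ (fun x => ψ x * φ x) x‖) := by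
      refine (g5.add h5).mono' (hcd.continuous_fderiv (by norm_num)).norm.aestronglyMeasurable
        (Filter.Eventually.of_forall fun x => ?_)
      rw [norm_norm]
      exact hbound x
    refine ⟨fun x => ψ x * φ x, hcd, fun x => ⟨mul_nonneg (g2 x).1 (h2 x).1,
      mul_le_one₀ (g2 x).2 (h2 x).1 (h2 x).2⟩, ?_, ?_, hi, ?_⟩
    · intro i hi x hx
      rcases Finset.mem_insert.1 hi with rfl | hi
      · simp [g3 x hx]
      · simp [h3 i hi x hx]
    · intro x hx
      simp [g4 x (hx a (Finset.mem_insert_self a T)),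
        h4 x fun i hi => hx i (Finset.mem_insert_of_mem hi)]
    · rw [Finset.sum_insert ha, mul_add]
      calc _ ≤ ∫ x, (‖fderiv ℝ ψ x‖ + ‖fderiv ℝ φ x‖) :=
            integral_mono hi (g5.add h5) hbound
        _ ≤ _ := by
            rw [integral_add g5 h5]
            exact add_le_add g6 h6

end Cutoff
end MFSBP

/-! ### The divergence theorem and derivatives up to the boundary. -/

namespace MFSBP

variable {d : ℕ} {Ω : Set (EuclideanSpace ℝ (Fin d))}

/-- Cutoff functions around a compact set of vanishing `(d-1)`-dimensional measure. -/
theorem exists_seq_cutoff (hd : 0 < d) {K : Set (EuclideanSpace ℝ (Fin d))} (hK : IsCompact K)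
    (h0 : μHE[d - 1] K = 0) : ∃ φ : ℕ → EuclideanSpace ℝ (Fin d) → ℝ,
      (∀ k, ContDiff ℝ 1 (φ k)) ∧ (∀ k x, φ k x ∈ Set.Icc (0 : ℝ) 1) ∧
      (∀ k, ∃ O, IsOpen O ∧ K ⊆ O ∧ ∀ x ∈ O, φ k x = 0) ∧
      (∀ x ∉ K, Filter.Tendsto (fun k => φ k x) Filter.atTop (𝓝 1)) ∧
      (∀ k, Integrable (fun x => ‖fderiv ℝ (φ k) x‖)) ∧
      Filter.Tendsto (fun k => ∫ x, ‖fderiv ℝ (φ k) x‖) Filter.atTop (𝓝 0) := by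
  obtain ⟨C, hC, hcut⟩ := exists_balls_cutoff hd
  have hε : ∀ k : ℕ, (0 : ℝ) < 1 / ((k : ℝ) + 1) := fun k => by positivity
  have hlim := tendsto_one_div_add_atTop_nhds_zero_nat (𝕜 := ℝ)
  choose T c r hr hcov hsum using fun k : ℕ => exists_finite_ball_cover hK h0 (hε k)
  choose φ h1 h2 h3 h4 h5 h6 using fun k : ℕ =>
    hcut (T k) (c k) (r k) fun i hi => (hr k i hi).2.1
  refine ⟨φ, h1, h2, fun k => ⟨⋃ i ∈ T k, Metric.ball (c k i) (r k i),
    isOpen_biUnion fun i _ => Metric.isOpen_ball, hcov k, fun x hx => ?_⟩, fun x hx => ?_, h5, ?_⟩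
  · obtain ⟨i, hi, hxi⟩ := Set.mem_iUnion₂.1 hx
    exact h3 k i hi x hxi
  · obtain ⟨δ, hδ, hball⟩ := Metric.isOpen_iff.1 hK.isClosed.isOpen_compl x hx
    refine tendsto_const_nhds.congr' ?_
    filter_upwards [hlim.eventually_lt_const (half_pos hδ)] with k hk
    refine (h4 k x fun i hi => ?_).symm
    by_contra hlt
    have hmem : c k i ∈ Metric.ball x δ := by
      rw [Metric.mem_ball, dist_comm]
      linarith [(hr k i hi).2.2]
    exact hball hmem (hr k i hi).1
  · refine squeeze_zero (fun k => integral_nonneg fun x => norm_nonneg _)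
      (fun k => (h6 k).trans (mul_le_mul_of_nonneg_left (hsum k).le hC)) ?_
    simpa using hlim.const_mul C

/-- The divergence theorem on a domain with piecewise smooth boundary. -/
theorem divergenceAlong_of_mem_C1Closure (hd : 0 < d) (hΩ : IsOpen Ω)
    (hΩb : Bornology.IsBounded Ω) (hΩs : HasPiecewiseSmoothBoundary Ω)
    (ξ : EuclideanSpace ℝ (Fin d)) {F : EuclideanSpace ℝ (Fin d) → ℝ} (hF : F ∈ C1Closure Ω) :
    DivergenceAlong Ω ξ F := by
  have := hΩs.isFiniteMeasure
  have hK : IsCompact (frontier Ω \ smoothBoundary Ω) := by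
    have h1 : IsCompact (frontier Ω) :=
      hΩb.isCompact_closure.of_isClosed_subset isClosed_frontier frontier_subset_closure
    rw [smoothBoundary_eq_inter, Set.sdiff_self_inter]
    exact h1.diff isOpen_setOf_isDefiningFunctionAt
  obtain ⟨φ, hφ1, hφ2, hφ3, hφ4, hφ5, hφ6⟩ := exists_seq_cutoff hd hK hΩs.measure_singular
  have hφm : ∀ k, φ k ∈ C1Closure Ω := fun k => contDiff_mem_C1Closure (hφ1 k)
  have hFi : IntegrableOn (fun y => inner ℝ (gradient F y) ξ) Ω :=
    integrableOn_inner_gradient hΩ hΩb hF ξ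
  have hSi := hΩs.integrable hΩ hΩb hF.2.1 ξ
  have hφabs : ∀ k x, ‖φ k x‖ ≤ 1 := fun k x => by
    rw [Real.norm_eq_abs, abs_of_nonneg (hφ2 k x).1]; exact (hφ2 k x).2
  obtain ⟨C, hC⟩ := hΩb.isCompact_closure.exists_bound_of_continuousOn hF.2.1
  have hgn : ∀ k x, ‖gradient (φ k) x‖ = ‖fderiv ℝ (φ k) x‖ := fun k x => by simp [gradient]
  have hi1 : ∀ k, IntegrableOn (fun y => φ k y * inner ℝ (gradient F y) ξ) Ω := fun k =>
    Integrable.bdd_mul hFi (hφ1 k).continuous.aestronglyMeasurable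
      (Filter.Eventually.of_forall (hφabs k))
  have hgc : ∀ k, Continuous (gradient (φ k)) := fun k =>
    (InnerProductSpace.toDual ℝ _).symm.continuous.comp ((hφ1 k).continuous_fderiv (by norm_num))
  have hi2 : ∀ k, IntegrableOn (fun y => F y * inner ℝ (gradient (φ k) y) ξ) Ω := fun k =>
    integrableOn_of_continuousOn_closure hΩb
      (hF.2.1.mul ((hgc k).continuousOn.inner continuousOn_const))
  -- `φ k * F` vanishes near the singular set, so the divergence theorem holds for it. The three
  -- terms are then passed to the limit separately.
  have hid : ∀ k, (∫ y in Ω, φ k y * inner ℝ (gradient F y) ξ)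
      + (∫ y in Ω, F y * inner ℝ (gradient (φ k) y) ξ)
      = surfaceIntegral Ω (fun y => φ k y * (F y * inner ℝ ξ (outwardNormal Ω y))) := by
    intro k
    obtain ⟨O, hO, hKO, hφO⟩ := hφ3 k
    have h1 := divergenceAlong_of_eq_zero_near_singular hΩ hΩb hΩs ξ
      (mul_mem_C1Closure hΩ (hφm k) hF) hO hKO fun x hx => by rw [hφO x hx, zero_mul]
    rw [DivergenceAlong] at h1
    rw [← integral_add (hi1 k) (hi2 k)]
    simp only [mul_assoc] at h1
    rw [← h1]
    refine setIntegral_congr_fun hΩ.measurableSet fun x hx => ?_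
    simp only [gradient_mul_of_mem hΩ (hφm k) hF hx, inner_add_left, real_inner_smul_left]
  have hlim1 : Filter.Tendsto (fun k => ∫ y in Ω, φ k y * inner ℝ (gradient F y) ξ) Filter.atTop
      (𝓝 (∫ y in Ω, inner ℝ (gradient F y) ξ)) := by
    refine tendsto_integral_of_dominated_convergence (fun y => ‖inner ℝ (gradient F y) ξ‖)
      (fun k => (hi1 k).aestronglyMeasurable) hFi.norm
      (fun k => Filter.Eventually.of_forall fun x => ?_) ?_
    · rw [norm_mul]
      exact mul_le_of_le_one_left (norm_nonneg _) (hφabs k x)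
    · refine (ae_restrict_iff' hΩ.measurableSet).2 (Filter.Eventually.of_forall fun x hx => ?_)
      have hxK : x ∉ frontier Ω \ smoothBoundary Ω := fun h => by
        have := h.1
        rw [hΩ.frontier_eq] at this
        exact this.2 hx
      simpa using (hφ4 x hxK).mul_const (inner ℝ (gradient F x) ξ)
  -- The error term is at most `sup |F| · ‖ξ‖` times the `L¹` norm of the derivative of the cutoff.
  have hlim2 : Filter.Tendsto (fun k => ∫ y in Ω, F y * inner ℝ (gradient (φ k) y) ξ) Filter.atTop
      (𝓝 0) := by
    have hb : ∀ k, ‖∫ y in Ω, F y * inner ℝ (gradient (φ k) y) ξ‖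
        ≤ (|C| * ‖ξ‖) * ∫ x, ‖fderiv ℝ (φ k) x‖ := by
      intro k
      calc _ ≤ ∫ y in Ω, (|C| * ‖ξ‖) * ‖fderiv ℝ (φ k) y‖ := by
            refine norm_integral_le_of_norm_le ((hφ5 k).const_mul _).integrableOn
              ((ae_restrict_iff' hΩ.measurableSet).2 (Filter.Eventually.of_forall fun x hx => ?_))
            rw [norm_mul, mul_assoc, ← hgn, mul_comm ‖ξ‖]
            exact mul_le_mul ((hC x (subset_closure hx)).trans (le_abs_self C))
              (norm_inner_le_norm _ _) (norm_nonneg _) (abs_nonneg _)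
        _ ≤ ∫ y, (|C| * ‖ξ‖) * ‖fderiv ℝ (φ k) y‖ :=
            setIntegral_le_integral ((hφ5 k).const_mul _)
              (Filter.Eventually.of_forall fun x => by positivity)
        _ = _ := integral_const_mul _ _
    refine squeeze_zero_norm hb ?_
    simpa using hφ6.const_mul (|C| * ‖ξ‖)
  have hlim3 : Filter.Tendsto
      (fun k => surfaceIntegral Ω (fun y => φ k y * (F y * inner ℝ ξ (outwardNormal Ω y))))
      Filter.atTop (𝓝 (surfaceIntegral Ω (fun y => F y * inner ℝ ξ (outwardNormal Ω y)))) := by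
    refine tendsto_integral_of_dominated_convergence
      (fun y => ‖F y * inner ℝ ξ (outwardNormal Ω y)‖)
      (fun k => (hφ1 k).continuous.aestronglyMeasurable.mul hSi.aestronglyMeasurable) hSi.norm
      (fun k => Filter.Eventually.of_forall fun x => ?_) ?_
    · rw [norm_mul]
      exact mul_le_of_le_one_left (norm_nonneg _) (hφabs k x)
    · filter_upwards [hΩs.ae_mem_smoothBoundary] with x hx
      simpa using (hφ4 x fun h => h.2 hx).mul_const (F x * inner ℝ ξ (outwardNormal Ω x))
  have hlim12 := hlim1.add hlim2
  simp only [hid, add_zero] at hlim12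
  exact tendsto_nhds_unique hlim12 hlim3

/-- Any continuous extension of the gradient computes `dirDeriv`, by uniqueness of limits; this
reduces the calculus rules on the closure to those in `Ω`. -/
theorem dirDeriv_eq {ξ x : EuclideanSpace ℝ (Fin d)} {f : EuclideanSpace ℝ (Fin d) → ℝ}
    {g : EuclideanSpace ℝ (Fin d) → EuclideanSpace ℝ (Fin d)} (hg : ContinuousOn g (closure Ω))
    (hgf : Set.EqOn g (gradient f) Ω) (hx : x ∈ closure Ω) :
    dirDeriv Ω ξ f x = inner ℝ (g x) ξ := by
  refine extendFrom_eq hx ?_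
  have h1 : Filter.Tendsto (fun y => inner ℝ (g y) ξ) (𝓝[Ω] x) (𝓝 (inner ℝ (g x) ξ)) :=
    (((hg x hx).mono subset_closure).inner continuousWithinAt_const).tendsto
  refine h1.congr' ?_
  filter_upwards [self_mem_nhdsWithin] with y hy
  rw [hgf hy]

theorem dirDeriv_add (hΩ : IsOpen Ω) {ξ x : EuclideanSpace ℝ (Fin d)}
    {f g : EuclideanSpace ℝ (Fin d) → ℝ} (hf : f ∈ C1Closure Ω) (hg : g ∈ C1Closure Ω)
    (hx : x ∈ closure Ω) :
    dirDeriv Ω ξ (f + g) x = dirDeriv Ω ξ f x + dirDeriv Ω ξ g x := by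
  obtain ⟨-, -, f', hf3, hf4⟩ := id hf
  obtain ⟨-, -, g', hg3, hg4⟩ := id hg
  rw [dirDeriv_eq hf3 hf4 hx, dirDeriv_eq hg3 hg4 hx, ← inner_add_left]
  refine dirDeriv_eq (g := fun y => f' y + g' y) (hf3.add hg3) (fun y hy => ?_) hx
  simp only [hf4 hy, hg4 hy]
  exact (gradient_add_of_mem hΩ hf hg hy).symm

theorem dirDeriv_mul (hΩ : IsOpen Ω) {ξ x : EuclideanSpace ℝ (Fin d)}
    {f g : EuclideanSpace ℝ (Fin d) → ℝ} (hf : f ∈ C1Closure Ω) (hg : g ∈ C1Closure Ω)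
    (hx : x ∈ closure Ω) : dirDeriv Ω ξ (fun y => f y * g y) x
      = f x * dirDeriv Ω ξ g x + g x * dirDeriv Ω ξ f x := by
  obtain ⟨-, hf2, f', hf3, hf4⟩ := id hf
  obtain ⟨-, hg2, g', hg3, hg4⟩ := id hg
  rw [dirDeriv_eq hf3 hf4 hx, dirDeriv_eq hg3 hg4 hx, ← real_inner_smul_left,
    ← real_inner_smul_left, ← inner_add_left]
  refine dirDeriv_eq (g := fun y => f y • g' y + g y • f' y)
    ((hf2.smul hg3).add (hg2.smul hf3)) (fun y hy => ?_) hx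
  simp only [hf4 hy, hg4 hy]
  exact (gradient_mul_of_mem hΩ hf hg hy).symm

theorem dirDeriv_const_smul (hΩ : IsOpen Ω) {ξ x : EuclideanSpace ℝ (Fin d)}
    {f : EuclideanSpace ℝ (Fin d) → ℝ} (hf : f ∈ C1Closure Ω) (a : ℝ) (hx : x ∈ closure Ω) :
    dirDeriv Ω ξ (a • f) x = a * dirDeriv Ω ξ f x := by
  have hc : (fun _ => a) ∈ C1Closure Ω := contDiff_mem_C1Closure contDiff_const
  have h0 : dirDeriv Ω ξ (fun _ => a) x = 0 := by
    rw [dirDeriv_eq (g := fun _ => 0) continuousOn_const (fun y _ => by simp [gradient]) hx,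
      inner_zero_left]
  have h1 := dirDeriv_mul (ξ := ξ) hΩ hc hf hx
  rw [h0, mul_zero, add_zero] at h1
  exact h1

theorem integral_dirDeriv_mul (hd : 0 < d) (hΩ : IsOpen Ω) (hΩb : Bornology.IsBounded Ω)
    (hΩs : HasPiecewiseSmoothBoundary Ω) (ξ : EuclideanSpace ℝ (Fin d))
    {f g : EuclideanSpace ℝ (Fin d) → ℝ} (hf : f ∈ C1Closure Ω) (hg : g ∈ C1Closure Ω) :
    ∫ y in Ω, dirDeriv Ω ξ (fun y => f y * g y) y =
      surfaceIntegral Ω (fun y => f y * g y * inner ℝ ξ (outwardNormal Ω y)) := by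
  have hfg := mul_mem_C1Closure hΩ hf hg
  rw [← divergenceAlong_of_mem_C1Closure hd hΩ hΩb hΩs ξ hfg]
  obtain ⟨-, -, g', hg3, hg4⟩ := hfg
  refine setIntegral_congr_fun hΩ.measurableSet fun x hx => ?_
  simp only [dirDeriv_eq hg3 hg4 (subset_closure hx), hg4 hx]

/-! ### Linear algebra -/

theorem exists_leftInverse_of_linearIndependent_col {N K : ℕ} {V : Matrix (Fin N) (Fin K) ℝ}
    (hV : LinearIndependent ℝ V.col) : ∃ L : Matrix (Fin K) (Fin N) ℝ, L * V = 1 := by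
  have hinj : Function.Injective (Matrix.toLin' V) := Matrix.mulVec_injective_iff.2 hV
  obtain ⟨g, hg⟩ := (Matrix.toLin' V).exists_leftInverse_of_injective (LinearMap.ker_eq_bot.2 hinj)
  refine ⟨LinearMap.toMatrix' g, ?_⟩
  apply Matrix.toLin'.injective
  rw [Matrix.toLin'_mul, Matrix.toLin'_toMatrix', hg, Matrix.toLin'_one]

/-- A skew-symmetric matrix with prescribed values on the columns of `V`. -/
theorem exists_skew_mul_eq {N K : ℕ} {V R : Matrix (Fin N) (Fin K) ℝ}
    (hV : LinearIndependent ℝ V.col) (hR : Vᵀ * R + Rᵀ * V = 0) :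
    ∃ S : Matrix (Fin N) (Fin N) ℝ, S + Sᵀ = 0 ∧ S * V = R := by
  obtain ⟨L, hL⟩ := exists_leftInverse_of_linearIndependent_col hV
  have hR' : Vᵀ * R = -(Rᵀ * V) := eq_neg_of_add_eq_zero_left hR
  -- `R L - Lᵀ Rᵀ` is skew but sends `V` to `R - Lᵀ Rᵀ V`. The last term corrects this, and it is
  -- skew because `hR` says that `Rᵀ V` is.
  refine ⟨R * L - Lᵀ * Rᵀ + Lᵀ * (Rᵀ * V) * L, ?_, ?_⟩
  · simp only [Matrix.transpose_add, Matrix.transpose_sub, Matrix.transpose_mul,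
      Matrix.transpose_transpose, hR', Matrix.neg_mul, Matrix.mul_neg, Matrix.mul_assoc]
    abel
  · rw [Matrix.add_mul, Matrix.sub_mul, Matrix.mul_assoc R, hL, Matrix.mul_assoc _ L, hL,
      Matrix.mul_assoc Lᵀ]
    simp

theorem dotProduct_diagonal_mulVec {N : ℕ} (w u v : Fin N → ℝ) :
    u ⬝ᵥ (Matrix.diagonal w *ᵥ v) = ∑ n, w n * (u n * v n) := by
  simp only [dotProduct, Matrix.mulVec_diagonal]
  exact Finset.sum_congr rfl fun n _ => by ring

end MFSBP

end

/-! ### The equivalence of operators and quadratures. -/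

theorem mainTheorem1 (d N K : ℕ) (hd : 0 < d)
    (Ω : Set (EuclideanSpace ℝ (Fin d))) (hΩo : IsOpen Ω) (hΩb : Bornology.IsBounded Ω)
    (hΩs : MFSBP.HasPiecewiseSmoothBoundary Ω)
    (ξ : EuclideanSpace ℝ (Fin d)) (hξ : ‖ξ‖ = 1)
    (x : Fin N → EuclideanSpace ℝ (Fin d)) (hx : Function.Injective x)
    (hxΩ : ∀ n, x n ∈ closure Ω)
    (F : Submodule ℝ (EuclideanSpace ℝ (Fin d) → ℝ))
    (hF : (F : Set (EuclideanSpace ℝ (Fin d) → ℝ)) ⊆ MFSBP.C1Closure Ω)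
    (b : Module.Basis (Fin K) ℝ F)
    (hV : LinearIndependent ℝ
      (MFSBP.vandermonde x (fun k => (b k : EuclideanSpace ℝ (Fin d) → ℝ))).col)
    (B : Matrix (Fin N) (Fin N) ℝ) (hBs : B.IsSymm) (hB : MFSBP.BoundaryExact Ω ξ F x B) :
    (∃ D P Q : Matrix (Fin N) (Fin N) ℝ, P.IsDiag ∧ MFSBP.IsMFSBP Ω ξ F x D P Q B) ↔
      ∃ w : Fin N → ℝ, (∀ n, 0 < w n) ∧
        MFSBP.IsExactQuadrature Ω x w (MFSBP.dirDerivProducts Ω ξ F) := by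
  have hquad : ∀ w : Fin N → ℝ, ∀ f ∈ F, ∀ g ∈ F,
      MFSBP.quadrature x w (MFSBP.dirDeriv Ω ξ (fun y => f y * g y)) =
        MFSBP.nodal x f ⬝ᵥ (Matrix.diagonal w *ᵥ MFSBP.nodal x (MFSBP.dirDeriv Ω ξ g)) +
        MFSBP.nodal x g ⬝ᵥ (Matrix.diagonal w *ᵥ MFSBP.nodal x (MFSBP.dirDeriv Ω ξ f)) := by
    intro w f hf g hg
    rw [MFSBP.dotProduct_diagonal_mulVec, MFSBP.dotProduct_diagonal_mulVec,
      ← Finset.sum_add_distrib, MFSBP.quadrature]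
    refine Finset.sum_congr rfl fun n _ => ?_
    rw [MFSBP.dirDeriv_mul hΩo (hF hf) (hF hg) (hxΩ n), mul_add]
    rfl
  constructor
  · rintro ⟨D, P, Q, hPd, hD, hDf, hP, hQ, -⟩
    refine ⟨P.diag, fun n => hP.diag_pos, ?_⟩
    rintro _ ⟨f, hf, g, hg, rfl⟩
    have hPD : P * D = Q := by
      rw [hD, Matrix.mul_nonsing_inv_cancel_left _ _ ((Matrix.isUnit_iff_isUnit_det P).1 hP.isUnit)]
    rw [MFSBP.integral_dirDeriv_mul hd hΩo hΩb hΩs ξ (hF hf) (hF hg), ← hB f hf g hg,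
      hquad _ f hf g hg, hPd.diagonal_diag, ← hDf f hf, ← hDf g hg, Matrix.mulVec_mulVec,
      Matrix.mulVec_mulVec, hPD, ← hQ, Matrix.add_mulVec, dotProduct_add]
    congr 1
    -- The remaining terms agree by transposition: `gᵀ Q f = fᵀ Qᵀ g`.
    rw [Matrix.mulVec_transpose, Matrix.dotProduct_mulVec, dotProduct_comm]
  · rintro ⟨w, hw, hex⟩
    set V := MFSBP.vandermonde x (fun k => (b k : EuclideanSpace ℝ (Fin d) → ℝ)) with hVdef
    set V' : Matrix (Fin N) (Fin K) ℝ := Matrix.of fun n k =>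
      MFSBP.dirDeriv Ω ξ (b k : EuclideanSpace ℝ (Fin d) → ℝ) (x n) with hV'
    set P : Matrix (Fin N) (Fin N) ℝ := Matrix.diagonal w with hP
    have hPpos : P.PosDef := Matrix.PosDef.diagonal hw
    have hent : ∀ i j, (Vᵀ * (P * V')) i j + (Vᵀ * (P * V')) j i = (Vᵀ * (B * V)) i j := by
      intro i j
      have h1 := hex _ ⟨b i, (b i).2, b j, (b j).2, rfl⟩
      rw [MFSBP.integral_dirDeriv_mul hd hΩo hΩb hΩs ξ (hF (b i).2) (hF (b j).2),
        ← hB _ (b i).2 _ (b j).2, hquad w _ (b i).2 _ (b j).2] at h1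
      exact h1
    -- Since `B` is symmetric, the two halves of `Vᵀ B V` add up to the symmetrised `Vᵀ P V'` given
    -- by `hent`.
    have hskew : Vᵀ * (P * V' - (1 / 2 : ℝ) • (B * V)) + (P * V' - (1 / 2 : ℝ) • (B * V))ᵀ * V
        = 0 := by
      have hN : (Vᵀ * (B * V))ᵀ = Vᵀ * (B * V) := by
        rw [Matrix.transpose_mul, Matrix.transpose_mul, hBs.eq, Matrix.transpose_transpose,
          Matrix.mul_assoc]
      have hM : Vᵀ * (P * V') + (Vᵀ * (P * V'))ᵀ = Vᵀ * (B * V) := Matrix.ext hent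
      have hR : Vᵀ * (P * V' - (1 / 2 : ℝ) • (B * V))
          = Vᵀ * (P * V') - (1 / 2 : ℝ) • (Vᵀ * (B * V)) := by
        rw [Matrix.mul_sub, Matrix.mul_smul]
      rw [← Matrix.transpose_transpose ((P * V' - (1 / 2 : ℝ) • (B * V))ᵀ * V),
        Matrix.transpose_mul, Matrix.transpose_transpose, hR, Matrix.transpose_sub,
        Matrix.transpose_smul, hN, sub_add_sub_comm, hM, ← add_smul]
      norm_num
    obtain ⟨S, hS, hSV⟩ := MFSBP.exists_skew_mul_eq hV hskew
    refine ⟨P⁻¹ * (S + (1 / 2 : ℝ) • B), P, S + (1 / 2 : ℝ) • B, Matrix.isDiag_diagonal w, rfl,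
      ?_, hPpos, ?_, hB⟩
    · have hDV : P⁻¹ * (S + (1 / 2 : ℝ) • B) * V = V' := by
        rw [Matrix.mul_assoc, Matrix.add_mul, hSV, Matrix.smul_mul, sub_add_cancel,
          Matrix.nonsing_inv_mul_cancel_left _ _
            ((Matrix.isUnit_iff_isUnit_det P).1 hPpos.isUnit)]
      -- `hDV` is exactness on the basis; both sides are linear in `f`, so it extends to all of `F`.
      let A₁ : F →ₗ[ℝ] (Fin N → ℝ) :=
        { toFun := fun f => (P⁻¹ * (S + (1 / 2 : ℝ) • B)) *ᵥ MFSBP.nodal x f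
          map_add' := fun f g => by rw [← Matrix.mulVec_add]; rfl
          map_smul' := fun a f => by rw [RingHom.id_apply, ← Matrix.mulVec_smul]; rfl }
      let A₂ : F →ₗ[ℝ] (Fin N → ℝ) :=
        { toFun := fun f => MFSBP.nodal x (MFSBP.dirDeriv Ω ξ f)
          map_add' := fun f g => funext fun n =>
            MFSBP.dirDeriv_add hΩo (hF f.2) (hF g.2) (hxΩ n)
          map_smul' := fun a f => funext fun n =>
            MFSBP.dirDeriv_const_smul hΩo (hF f.2) a (hxΩ n) }
      have hA : A₁ = A₂ := b.ext fun k => funext fun n => congrFun (congrFun hDV n) k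
      intro f hf
      exact LinearMap.congr_fun hA ⟨f, hf⟩
    · rw [Matrix.transpose_add, Matrix.transpose_smul, hBs.eq, add_add_add_comm, hS, zero_add,
        ← add_smul]
      norm_num
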